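/- Let $n=n_l+n_f$ agents in $\mathbb R^3$ be given, leaders $1,\dots,n_l$ and followers $n_l+1,\dots,n$, with a directed graph without self-loops (neighbour sets $\mathcal N_i$), nominal positions $r_i\in\mathbb R^3$, and for every follower $i$ weights $w_{ij}$ with $\sum_{j\in\mathcal N_i}w_{ij}(r_i-r_j)=0$ and $\sum_{j\in\mathcal N_i}|w_{ij}|>0$. Let $\Omega_f=[\Omega_{fl}\ \Omega_{ff}]\in\mathbb R^{n_f\times n}$ have, in the row of follower $i$, the entries $-w_{ij}$ for $j\in\mathcal N_i$, $\sum_{k\in\mathcal N_i}w_{ik}$ for $j=i$, and $0$ otherwise. Assume that $\Omega_{ff}$ is nonsingular (the nominal formation is localizable). Let $\sigma_{ij}$ be the entries of $\Omega_{ff}^{-1}\Omega_{fl}$, $\sigma=\max_{i,j}|\sigma_{ij}|$, and $\bar w_{ij}=-[\Omega_{ff}^{-1}\Omega_f]_{ij}$ for $j\ne i$. Let $m\ge 1$. Agent $i$ has motion state $x_i=(p_i^\top,\dots,(p_i^{(m-1)})^\top)^\top\in\mathbb R^{3m}$, dynamics $\dot x_i=Ax_i+Bu_i$ with $A=N\otimes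 I_3$ ($N$ the $m\times m$ matrix with ones on the superdiagonal and zeros elsewhere), $B=(0,\dots,0,1)^\top\otimes I_3$, output $y_i=Cx_i$ with $C\in\mathbb R^{q\times 3m}$, and a state estimate $\eta_i$; put $z_i=(x_i^\top,\eta_i^\top)^\top$. Let $P,H$ be positive definite with $$AP+PA^\top-2BB^\top<0,\qquad A^\top H+HA-2C^\top C<0,$$ and let $K=-B^\top P^{-1}$, $L=-H^{-1}C^\top$. Leaders. The desired trajectory $p_i^*:[0,\infty)\to\mathbb R^3$ of each leader is $m$ times differentiable with $\|p_i^{*(k)}(t)\|_2\le\gamma_k$ for $k=1,\dots,m$; $x_i^*=(p_i^{*\top},\dots,(p_i^{*(m-1)})^\top)^\top$. The leaders run $$\dot\eta_i=A\eta_i+Bu_i+L(C\eta_i-y_i),\qquad u_i=(\beta\otimes I_3)^\top(\eta_i-x_i^*)+p_i^{*(m)},$$ where $\beta=(\beta_0,\dots,\beta_{m-1})^\top$ and $W_1=N+W_2$ is Hurwitz, $W_2$ being the $m\times m$ matrix with last row $\beta^\top$ and zeros elsewhere. Their initial errors satisfy $\|x_i(0)-x_i^*(0)\|_2\le\zeta$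 and $\|\eta_i(0)-x_i(0)\|_2\le\zeta$. Let $\gamma_u$ be either any number with $\|u_i(t)\|_2\le\gamma_u$ for all leaders $i$ and all $t\ge0$, or the number $$\gamma_u=4\psi\zeta\|\beta\|_2\|M\|_2\|M^{-1}\|_2+\gamma_m,\qquad \psi=\sqrt{6m+3m(6m-1)\Big(\tfrac{6m-1}{|\lambda_{\max}(W)|\,e}\Big)^{6m-1}},$$ where $W=\begin{bmatrix}W_1\otimes I_3&W_2\otimes I_3\\0&A+LC\end{bmatrix}=MJM^{-1}$ with $J$ in Jordan form, and $\lambda_{\max}(W)$ is an eigenvalue of $W$ with largest real part. Followers. Let $c_1>1$ and $c_2\ge n_l\,\sigma\,\gamma_u$. Each follower $i$ runs $$\dot\eta_i=A\eta_i+Bu_i+L(C\eta_i-y_i)+c_1L\sum_{j=1}^n\bar w_{ij}\big[C(\eta_i-\eta_j)-(y_i-y_j)\big],$$ $$u_i=c_1K\sum_{j=1}^n\bar w_{ij}(\eta_i-\eta_j)+c_2\,\mathrm{sgn}\Big[K\sum_{j=1}^n\bar w_{ij}(\eta_i-\eta_j)\Big],$$ with $\mathrm{sgn}$ taken componentwise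 and $\mathrm{sgn}(0)=0$. Let $z_l$ and $z_f$ be the stacked vectors of the $z_i$ of the leaders and of the followers. Then for every Filippov solution $z_f$ of the follower closed loop on $[0,\infty)$ (with arbitrary initial value), $$e_f(t)=z_f(t)+(\Omega_{ff}^{-1}\Omega_{fl}\otimes I_{6m})\,z_l(t)\longrightarrow 0\qquad(t\to\infty).$$ -/

import Mathlib

open scoped Matrix Kronecker
open MeasureTheory Filter Topology

namespace Formation

noncomputable section

/-! ### Filippov solutions -/

/-- The Euclidean norm of a finite real vector. -/
def norm2 {ι : Type*} [Fintype ι] (v : ι → ℝ) : ℝ := ‖WithLp.toLp 2 v‖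

/-- The set-valued map `K[f](x,t)`: the intersection, over all `δ > 0` and all Lebesgue-null
sets `N`, of the closed convex hull of `f(B(x,δ) ∖ N, t)`. -/
def filippovMap {ι : Type*} [Fintype ι] (f : (ι → ℝ) → ℝ → (ι → ℝ)) (x : ι → ℝ) (t : ℝ) :
    Set (ι → ℝ) :=
  ⋂ (δ : ℝ) (_ : 0 < δ) (N : Set (ι → ℝ)) (_ : volume N = 0),
    closedConvexHull ℝ ((fun y => f y t) '' ({y | norm2 (y - x) < δ} \ N))

/-- `x` is a Filippov solution of `ẋ = f(x,t)` on `[t₀,t₁]`: it is absolutely continuous there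
and `ẋ(t) ∈ K[f](x(t),t)` for almost every `t` in the interval. -/
def IsFilippovSolutionOn {ι : Type*} [Fintype ι] (f : (ι → ℝ) → ℝ → (ι → ℝ)) (x : ℝ → (ι → ℝ))
    (t₀ t₁ : ℝ) : Prop :=
  AbsolutelyContinuousOnInterval x t₀ t₁ ∧
    ∀ᵐ t ∂(volume.restrict (Set.Icc t₀ t₁)), ∃ v ∈ filippovMap f (x t) t, HasDerivAt x v t

/-- `x` is a Filippov solution on `[0,∞)`, that is, on every `[0,T]`. -/
def IsFilippovSolution {ι : Type*} [Fintype ι] (f : (ι → ℝ) → ℝ → (ι → ℝ))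
    (x : ℝ → (ι → ℝ)) : Prop :=
  ∀ T : ℝ, 0 < T → IsFilippovSolutionOn f x 0 T

/-- `x` is a Carathéodory solution of `ẋ = f(x,t)` on `[0,∞)`: it is absolutely continuous on
every `[0,T]` and satisfies the equation almost everywhere. -/
def IsCaratheodorySolution {ι : Type*} [Fintype ι] (f : (ι → ℝ) → ℝ → (ι → ℝ))
    (x : ℝ → (ι → ℝ)) : Prop :=
  ∀ T : ℝ, 0 < T → AbsolutelyContinuousOnInterval x 0 T ∧
    ∀ᵐ t ∂(volume.restrict (Set.Icc 0 T)), HasDerivAt x (f (x t) t) t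

/-! ### Nominal formations and the follower matrix -/

/-- The agents: `n_l` leaders followed by `n_f` followers. -/
abbrev Agent (nl nf : ℕ) : Type := Fin nl ⊕ Fin nf

/-- A nominal formation in 3-D space with a displacement parameter set for every follower:
`∑_{j ∈ N_i} w_ij (r_i - r_j) = 0` and `∑_{j ∈ N_i} |w_ij| > 0`. -/
structure NominalFormation (nl nf : ℕ) where
  /-- the directed communication graph; `j` is a neighbour of `i` when `graph.Adj i j` -/
  graph : Digraph (Agent nl nf)
  /-- there are no self-loops -/
  loopless : ∀ i, ¬ graph.Adj i i
  /-- the nominal positions -/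
  r : Agent nl nf → Fin 3 → ℝ
  /-- the displacement parameters of the followers -/
  w : Fin nf → Agent nl nf → ℝ
  displacement : ∀ i : Fin nf,
    open Classical in
    ∑ j with graph.Adj (Sum.inr i) j, w i j • (r (Sum.inr i) - r j) = 0
  nonzero : ∀ i : Fin nf,
    open Classical in
    0 < ∑ j with graph.Adj (Sum.inr i) j, |w i j|

namespace NominalFormation

variable {nl nf : ℕ} (F : NominalFormation nl nf)

/-- The follower matrix `Ω_f`. -/
def followerMatrix : Matrix (Fin nf) (Agent nl nf) ℝ :=
  open Classical in
  Matrix.of fun i j =>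
    if j = Sum.inr i then ∑ k with F.graph.Adj (Sum.inr i) k, F.w i k
    else if F.graph.Adj (Sum.inr i) j then - F.w i j
    else 0

/-- The leader block `Ω_fl` of the follower matrix. -/
def Ωfl : Matrix (Fin nf) (Fin nl) ℝ := F.followerMatrix.submatrix id Sum.inl

/-- The follower block `Ω_ff` of the follower matrix. -/
def Ωff : Matrix (Fin nf) (Fin nf) ℝ := F.followerMatrix.submatrix id Sum.inr

/-- The nominal formation is localizable: `Ω_ff` is nonsingular. -/
def Localizable : Prop := IsUnit F.Ωff.det

/-- The edge weights `w̄_ij`, given by `[Ω̄_f]_ij = -w̄_ij` for `j ≠ i`, where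
`Ω̄_f = Ω_ff⁻¹ Ω_f`. (The value for `j = i` plays no role.) -/
def wbar (i : Fin nf) (j : Agent nl nf) : ℝ := - (F.Ωff⁻¹ * F.followerMatrix) i j

/-- `σ = max_{i,j} |σ_ij|`, where `σ_ij` is the `(i,j)` entry of `Ω_ff⁻¹ Ω_fl`. -/
def σ : ℝ := ⨆ p : Fin nf × Fin nl, |(F.Ωff⁻¹ * F.Ωfl) p.1 p.2|

end NominalFormation

/-! ### The agents -/

/-- Coordinates of the motion state `(p, p⁽¹⁾, …, p⁽ᵐ⁻¹⁾) ∈ ℝ^{3m}` of an agent. -/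
abbrev St (m : ℕ) : Type := Fin m × Fin 3

/-- Coordinates of `z_i = (x_i, η_i) ∈ ℝ^{6m}`: motion state and its estimate. -/
abbrev Zt (m : ℕ) : Type := St m ⊕ St m

/-- The `m × m` shift matrix (ones on the superdiagonal). -/
def shift (m : ℕ) : Matrix (Fin m) (Fin m) ℝ :=
  Matrix.of fun i j => if (j : ℕ) = (i : ℕ) + 1 then 1 else 0

/-- `A = shift ⊗ I₃`. -/
def sysA (m : ℕ) : Matrix (St m) (St m) ℝ := shift m ⊗ₖ (1 : Matrix (Fin 3) (Fin 3) ℝ)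

/-- `B = (0, …, 0, 1)ᵀ ⊗ I₃`. -/
def sysB (m : ℕ) : Matrix (St m) (Fin 3) ℝ :=
  Matrix.of fun s a => if (s.1 : ℕ) + 1 = m ∧ s.2 = a then 1 else 0

variable {m q nl nf : ℕ}

/-- Motion state of agent `i` in a stacked vector of `z_i`'s. -/
def stX {n : ℕ} (z : Fin n × Zt m → ℝ) (i : Fin n) : St m → ℝ := fun s => z (i, Sum.inl s)

/-- Motion state estimate of agent `i` in a stacked vector of `z_i`'s. -/
def stE {n : ℕ} (z : Fin n × Zt m → ℝ) (i : Fin n) : St m → ℝ := fun s => z (i, Sum.inr s)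

/-! ### The leaders -/

/-- The `k`-th derivative of a trajectory defined on the time interval `[0,∞)`. -/
def trajDeriv (k : ℕ) (p : ℝ → Fin 3 → ℝ) : ℝ → Fin 3 → ℝ :=
  iteratedDerivWithin k p (Set.Ici 0)

/-- For `k = 1, …, m` the trajectory `p` is `k` times differentiable on `[0,∞)` and its `k`-th
derivative is bounded by `γ k`. -/
def BoundedDerivs (m : ℕ) (γ : ℕ → ℝ) (p : ℝ → Fin 3 → ℝ) : Prop :=
  (∀ k < m, DifferentiableOn ℝ (trajDeriv k p) (Set.Ici 0)) ∧
    ∀ k, 1 ≤ k → k ≤ m → ∀ t, 0 ≤ t → norm2 (trajDeriv k p t) ≤ γ k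

/-- The desired motion state `x* = (p*, p*⁽¹⁾, …, p*⁽ᵐ⁻¹⁾)`. -/
def desiredState (m : ℕ) (p : ℝ → Fin 3 → ℝ) (t : ℝ) : St m → ℝ :=
  fun s => trajDeriv s.1 p t s.2

/-- The leader control law `u_i = (β ⊗ I₃)ᵀ (η_i - x_i*) + p_i*⁽ᵐ⁾`. -/
def leaderInput (β : Fin m → ℝ) (p : Fin nl → ℝ → Fin 3 → ℝ) (z : Fin nl × Zt m → ℝ) (t : ℝ)
    (i : Fin nl) : Fin 3 → ℝ :=
  fun a => ∑ k, β k * (stE z i (k, a) - desiredState m (p i) t (k, a)) + trajDeriv m (p i) t a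

/-- The closed loop of the leaders:
`ẋ_i = A x_i + B u_i`, `η̇_i = A η_i + B u_i + L (C η_i - y_i)`, `y_i = C x_i`. -/
def leaderField (C : Matrix (Fin q) (St m) ℝ) (L : Matrix (St m) (Fin q) ℝ) (β : Fin m → ℝ)
    (p : Fin nl → ℝ → Fin 3 → ℝ) (z : Fin nl × Zt m → ℝ) (t : ℝ) : Fin nl × Zt m → ℝ :=
  fun is =>
    let i := is.1
    let u := leaderInput β p z t i
    match is.2 with
    | Sum.inl s => (sysA m *ᵥ stX z i + sysB m *ᵥ u) s
    | Sum.inr s => (sysA m *ᵥ stE z i + sysB m *ᵥ u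
        + L *ᵥ (C *ᵥ stE z i - C *ᵥ stX z i)) s

/-- The matrix with `β₀, …, β_{m-1}` in its last row and zeros elsewhere. -/
def W₂ (β : Fin m → ℝ) : Matrix (Fin m) (Fin m) ℝ :=
  Matrix.of fun i j => if (i : ℕ) + 1 = m then β j else 0

/-- The companion matrix of the leaders' tracking error. -/
def W₁ (β : Fin m → ℝ) : Matrix (Fin m) (Fin m) ℝ := shift m + W₂ β

/-- All complex eigenvalues have negative real part. -/
def IsHurwitz {n : Type*} [Fintype n] [DecidableEq n] (X : Matrix n n ℝ) : Prop :=
  ∀ μ ∈ spectrum ℂ (X.map Complex.ofReal), μ.re < 0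

/-- The matrix `W = [W₁ ⊗ I₃, W₂ ⊗ I₃; 0, A + L C]` of the leaders' error dynamics. -/
def leaderErrorMatrix (C : Matrix (Fin q) (St m) ℝ) (L : Matrix (St m) (Fin q) ℝ)
    (β : Fin m → ℝ) : Matrix (Zt m) (Zt m) ℝ :=
  Matrix.fromBlocks (W₁ β ⊗ₖ (1 : Matrix (Fin 3) (Fin 3) ℝ))
    (W₂ β ⊗ₖ (1 : Matrix (Fin 3) (Fin 3) ℝ)) 0 (sysA m + L * C)

/-- `J` is in (upper) Jordan normal form. -/
def IsJordanForm {N : ℕ} (J : Matrix (Fin N) (Fin N) ℂ) : Prop :=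
  ∀ i j : Fin N,
    (j ≠ i → (j : ℕ) ≠ (i : ℕ) + 1 → J i j = 0) ∧
    ((j : ℕ) = (i : ℕ) + 1 → J i j = 0 ∨ (J i j = 1 ∧ J i i = J j j))

/-- `l` is an eigenvalue of `X` with the largest real part. -/
def IsMaxEigenvalue {n : Type*} [Fintype n] [DecidableEq n] (X : Matrix n n ℝ) (l : ℂ) : Prop :=
  l ∈ spectrum ℂ (X.map Complex.ofReal) ∧
    ∀ μ ∈ spectrum ℂ (X.map Complex.ofReal), μ.re ≤ l.re

/-- `ψ = √(6m + 3m(6m-1)((6m-1)/(|λ_max(W)| e))^{6m-1})`, as a function of `l = λ_max(W)`. -/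
def psi (m : ℕ) (l : ℂ) : ℝ :=
  Real.sqrt (6 * m + 3 * m * (6 * m - 1) *
    ((6 * m - 1) / (‖l‖ * Real.exp 1)) ^ (6 * m - 1))

open scoped Matrix.Norms.L2Operator in
/-- `γu = 4 ψ ζ ‖β‖₂ ‖M‖₂ ‖M⁻¹‖₂ + γm` for a Jordan decomposition `W = M J M⁻¹` of the matrix of
the leaders' error dynamics, with spectral norms of `M` and `M⁻¹`. -/
def IsLeaderInputConstant (C : Matrix (Fin q) (St m) ℝ) (L : Matrix (St m) (Fin q) ℝ)
    (β : Fin m → ℝ) (ζ γm γu : ℝ) : Prop :=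
  ∃ (M : Matrix (Zt m) (Fin (6 * m)) ℂ) (Minv : Matrix (Fin (6 * m)) (Zt m) ℂ)
    (J : Matrix (Fin (6 * m)) (Fin (6 * m)) ℂ) (l : ℂ),
    M * Minv = 1 ∧ Minv * M = 1 ∧ IsJordanForm J ∧
    (leaderErrorMatrix C L β).map Complex.ofReal = M * J * Minv ∧
    IsMaxEigenvalue (leaderErrorMatrix C L β) l ∧
    γu = 4 * psi m l * ζ * norm2 β * ‖M‖ * ‖Minv‖ + γm

/-! ### The followers -/

/-- The componentwise sign. -/
def sgn {ι : Type*} (v : ι → ℝ) : ι → ℝ := fun i => Real.sign (v i)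

/-- The follower control law
`u_i = c₁ K ∑_j w̄_ij (η_i - η_j) + c₂ sgn(K ∑_j w̄_ij (η_i - η_j))`,
where `η` lists the estimates of all agents. -/
def followerInput (F : NominalFormation nl nf) (K : Matrix (Fin 3) (St m) ℝ) (c₁ c₂ : ℝ)
    (η : Agent nl nf → St m → ℝ) (i : Fin nf) : Fin 3 → ℝ :=
  let ξ : St m → ℝ := ∑ j, F.wbar i j • (η (Sum.inr i) - η j)
  c₁ • (K *ᵥ ξ) + c₂ • sgn (K *ᵥ ξ)

/-- The closed loop of the followers for given stacked leader states `zl`: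
`ẋ_i = A x_i + B u_i` and
`η̇_i = A η_i + B u_i + L (C η_i - y_i) + c₁ L ∑_j w̄_ij [C (η_i - η_j) - (y_i - y_j)]`,
with `y_i = C x_i`. -/
def followerField (F : NominalFormation nl nf) (C : Matrix (Fin q) (St m) ℝ)
    (K : Matrix (Fin 3) (St m) ℝ) (L : Matrix (St m) (Fin q) ℝ) (c₁ c₂ : ℝ)
    (zl : Fin nl × Zt m → ℝ) (zf : Fin nf × Zt m → ℝ) : Fin nf × Zt m → ℝ :=
  let x : Agent nl nf → St m → ℝ := Sum.elim (stX zl) (stX zf)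
  let η : Agent nl nf → St m → ℝ := Sum.elim (stE zl) (stE zf)
  let y : Agent nl nf → Fin q → ℝ := fun j => C *ᵥ x j
  fun is =>
    let i : Agent nl nf := Sum.inr is.1
    let u := followerInput F K c₁ c₂ η is.1
    match is.2 with
    | Sum.inl s => (sysA m *ᵥ x i + sysB m *ᵥ u) s
    | Sum.inr s => (sysA m *ᵥ η i + sysB m *ᵥ u + L *ᵥ (C *ᵥ η i - y i)
        + c₁ • (L *ᵥ ∑ j, F.wbar is.1 j • (C *ᵥ (η i - η j) - (y i - y j)))) s

/-- The tracking error `e_f = z_f + (Ω_ff⁻¹ Ω_fl ⊗ I_{6m}) z_l` of the followers. -/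
def followerError (F : NominalFormation nl nf) (zl : Fin nl × Zt m → ℝ)
    (zf : Fin nf × Zt m → ℝ) : Fin nf × Zt m → ℝ :=
  zf + ((F.Ωff⁻¹ * F.Ωfl) ⊗ₖ (1 : Matrix (Zt m) (Zt m) ℝ)) *ᵥ zl

end

end Formation

/-! Rows of `Ω_f` sum to zero, so `Ω_ff⁻¹Ω_f = [σ_ij | I]` also has zero row sums: the weights `w̄`
between distinct followers vanish, and those to the leaders are `-σ_ij` with sum 1. Hence `∑ w̄_ij
(η_i - η_j)` is exactly the estimate component `e` of the tracking error of follower `i`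
(`sum_wbar_smul_sub`), and the error system splits into independent systems, one per follower.

Let `D` be the estimate component minus the state component of that error. Inputs cancel in `D`, so
`Ḋ = (A + (1+c₁)LC) D`, and the Lyapunov function `DᵀHD` gives `D → 0`. Next, `e` obeys `ė = Ae +
B(c₁Ke + c₂ sgn(Ke) + d) + (1+c₁)LCD` with `d = ∑ σ_ij u_j`. Along `V = eᵀP⁻¹e` the input
contributes `-2 (Ke)·(c₁Ke + c₂ sgn(Ke) + d)`: the linear term completes the Lyapunov inequality,
the sign term dominates `d`, and the `D` term vanishes in the limit (`tendsto_estimated_error`).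

Domination is needed only up to a vanishing excess. The leader inputs converge to `p*⁽ᵐ⁾`, which is
bounded by `γ_m`; so for the explicit constant it is enough that `γ_m ≤ γ_u`.

The set-valued Filippov velocity enters through just two kinds of linear functionals: the
coordinates of `D` and the derivative of `V`. Each becomes continuous at the current point when
composed with the field, hence is single-valued on the Filippov set
(`linear_eq_of_mem_filippovMap`), so no set-valued calculus is required. -/

namespace Formation

/-! ### Locally absolutely continuous functions on `[0,∞)` -/

/-- `y` is absolutely continuous on every `[0,T]`, with derivative `y'` at almost every time. -/
structure HasAEDeriv {E : Type*} [NormedAddCommGroup E] [NormedSpace ℝ E] (y y' : ℝ → E) :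
    Prop where
  ac : ∀ T : ℝ, 0 < T → AbsolutelyContinuousOnInterval y 0 T
  ae_hasDerivAt : ∀ᵐ t ∂(volume.restrict (Set.Ici (0 : ℝ))), HasDerivAt y (y' t) t

theorem absolutelyContinuousOnInterval_lipschitz_comp {X Y : Type*} [PseudoMetricSpace X]
    [PseudoMetricSpace Y] {f : X → Y} {k : NNReal} (hf : LipschitzWith k f) {y : ℝ → X} {a b : ℝ}
    (hy : AbsolutelyContinuousOnInterval y a b) :
    AbsolutelyContinuousOnInterval (fun t => f (y t)) a b := by
  unfold AbsolutelyContinuousOnInterval at *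
  refine squeeze_zero (fun _ => Finset.sum_nonneg fun _ _ => dist_nonneg) (fun E => ?_)
    (by simpa using hy.const_mul (k : ℝ))
  rw [Finset.mul_sum]
  exact Finset.sum_le_sum fun i _ => hf.dist_le_mul _ _

theorem ae_restrict_Ici_of_forall_Icc {p : ℝ → Prop}
    (h : ∀ T : ℝ, 0 < T → ∀ᵐ t ∂(volume.restrict (Set.Icc 0 T)), p t) :
    ∀ᵐ t ∂(volume.restrict (Set.Ici (0 : ℝ))), p t := by
  have h' : ∀ n : ℕ, ∀ᵐ t : ℝ, t ∈ Set.Icc (0 : ℝ) (n + 1) → p t := fun n =>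
    (ae_restrict_iff' measurableSet_Icc).1 (h (n + 1) (by positivity))
  rw [ae_restrict_iff' measurableSet_Ici]
  filter_upwards [ae_all_iff.2 h'] with t ht ht0
  obtain ⟨n, hn⟩ := exists_nat_ge t
  exact ht n ⟨ht0, by linarith⟩

namespace HasAEDeriv

variable {E G : Type*} [NormedAddCommGroup E] [NormedSpace ℝ E] [NormedAddCommGroup G]
  [NormedSpace ℝ G] {y y' z z' : ℝ → E}

theorem congr (h : HasAEDeriv y y')
    (he : ∀ᵐ t ∂(volume.restrict (Set.Ici (0 : ℝ))), y' t = z' t) : HasAEDeriv y z' := by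
  refine ⟨h.ac, ?_⟩
  filter_upwards [h.ae_hasDerivAt, he] with t h1 h2
  rwa [← h2]

theorem clm_comp (h : HasAEDeriv y y') (f : E →L[ℝ] G) :
    HasAEDeriv (fun t => f (y t)) (fun t => f (y' t)) := by
  refine ⟨fun T hT => absolutelyContinuousOnInterval_lipschitz_comp f.lipschitz (h.ac T hT), ?_⟩
  filter_upwards [h.ae_hasDerivAt] with t ht
  exact f.hasFDerivAt.comp_hasDerivAt t ht

theorem linear_comp [FiniteDimensional ℝ E] (h : HasAEDeriv y y') (f : E →ₗ[ℝ] G) :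
    HasAEDeriv (fun t => f (y t)) (fun t => f (y' t)) :=
  h.clm_comp (LinearMap.toContinuousLinearMap f)

theorem add (h : HasAEDeriv y y') (k : HasAEDeriv z z') :
    HasAEDeriv (fun t => y t + z t) (fun t => y' t + z' t) := by
  refine ⟨fun T hT => (h.ac T hT).fun_add (k.ac T hT), ?_⟩
  filter_upwards [h.ae_hasDerivAt, k.ae_hasDerivAt] with t h1 h2
  exact h1.add h2

theorem sub (h : HasAEDeriv y y') (k : HasAEDeriv z z') :
    HasAEDeriv (fun t => y t - z t) (fun t => y' t - z' t) := by
  refine ⟨fun T hT => (h.ac T hT).fun_sub (k.ac T hT), ?_⟩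
  filter_upwards [h.ae_hasDerivAt, k.ae_hasDerivAt] with t h1 h2
  exact h1.sub h2

theorem mul {u u' v v' : ℝ → ℝ} (h : HasAEDeriv u u') (k : HasAEDeriv v v') :
    HasAEDeriv (fun t => u t * v t) (fun t => u' t * v t + u t * v' t) := by
  refine ⟨fun T hT => (h.ac T hT).fun_mul (k.ac T hT), ?_⟩
  filter_upwards [h.ae_hasDerivAt, k.ae_hasDerivAt] with t h1 h2
  exact h1.mul h2

theorem const (c : E) : HasAEDeriv (fun _ => c) (fun _ => 0) :=
  ⟨fun _ _ => ((LipschitzWith.const c).lipschitzOnWith).absolutelyContinuousOnInterval,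
    Eventually.of_forall fun t => hasDerivAt_const t c⟩

theorem sum {ι : Type*} (s : Finset ι) {y y' : ι → ℝ → E} (h : ∀ i, HasAEDeriv (y i) (y' i)) :
    HasAEDeriv (fun t => ∑ i ∈ s, y i t) (fun t => ∑ i ∈ s, y' i t) := by
  classical
  induction s using Finset.induction_on with
  | empty => simpa using const (0 : E)
  | insert i s hi ih => simpa [Finset.sum_insert hi] using (h i).add ih

theorem dotProduct_mulVec {ι : Type*} [Fintype ι] {e e' : ℝ → ι → ℝ} (h : HasAEDeriv e e')
    {S : Matrix ι ι ℝ} (hS : S.IsHermitian) :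
    HasAEDeriv (fun t => e t ⬝ᵥ S *ᵥ e t) (fun t => 2 * ((S *ᵥ e t) ⬝ᵥ e' t)) := by
  have h1 : ∀ i, HasAEDeriv (fun t => e t i) (fun t => e' t i) := fun i =>
    h.linear_comp (LinearMap.proj i)
  have h2 : ∀ i, HasAEDeriv (fun t => (S *ᵥ e t) i) (fun t => (S *ᵥ e' t) i) := fun i =>
    h.linear_comp ((LinearMap.proj i).comp S.mulVecLin)
  refine (sum Finset.univ fun i => (h1 i).mul (h2 i)).congr (Eventually.of_forall fun t => ?_)
  have hS' : e t ⬝ᵥ S *ᵥ e' t = (S *ᵥ e t) ⬝ᵥ e' t := by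
    have : Sᵀ = S := by simpa [Matrix.IsHermitian] using hS
    rw [Matrix.dotProduct_mulVec, ← Matrix.mulVec_transpose, this]
  have h3 : (S *ᵥ e t) ⬝ᵥ e' t = e' t ⬝ᵥ S *ᵥ e t := dotProduct_comm _ _
  rw [Finset.sum_add_distrib]
  change e' t ⬝ᵥ S *ᵥ e t + e t ⬝ᵥ S *ᵥ e' t = _
  rw [hS', h3]; ring

/-- Absolute continuity is what makes an almost-everywhere sign condition sufficient: `V b - V a` is
the integral of the derivative. -/
theorem antitone {V V' : ℝ → ℝ} (h : HasAEDeriv V V') {a b : ℝ} (ha : 0 ≤ a) (hab : a ≤ b)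
    (hV : ∀ᵐ t ∂(volume.restrict (Set.Ici (0 : ℝ))), a ≤ t → V' t ≤ 0) : V b ≤ V a := by
  have hac : AbsolutelyContinuousOnInterval V a b := by
    refine (h.ac (b + 1) (by linarith)).mono ?_
    rw [Set.uIcc_of_le hab, Set.uIcc_of_le (by linarith)]
    exact Set.Icc_subset_Icc ha (by linarith)
  have hI := hac.integral_deriv_eq_sub
  have : ∫ t in a..b, deriv V t ≤ 0 := by
    have h0 : 0 ≤ ∫ t in a..b, -deriv V t := by
      apply intervalIntegral.integral_nonneg_of_ae_restrict hab
      have hm : ∀ᵐ t ∂(volume.restrict (Set.Icc a b)), t ∈ Set.Icc a b :=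
        ae_restrict_mem measurableSet_Icc
      have hle : volume.restrict (Set.Icc a b) ≤ volume.restrict (Set.Ici (0 : ℝ)) :=
        Measure.restrict_mono (fun t ht => ha.trans ht.1) le_rfl
      filter_upwards [hm, (ae_mono hle) hV, (ae_mono hle) h.ae_hasDerivAt]
        with t h1 h2 h3
      simp [h3.deriv, h2 h1.1]
    rw [intervalIntegral.integral_neg] at h0
    linarith
  linarith

/-- A nonnegative function with `V' ≤ -α V + h`, where `h → 0`, converges to `0`. -/
theorem tendsto_zero {V V' k : ℝ → ℝ} (h : HasAEDeriv V V') (h0 : ∀ t, 0 ≤ V t) {α : ℝ}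
    (hα : 0 < α) (hk : Tendsto k atTop (𝓝 0))
    (hV : ∀ᵐ t ∂(volume.restrict (Set.Ici (0 : ℝ))), V' t ≤ -α * V t + k t) :
    Tendsto V atTop (𝓝 0) := by
  have hexp : HasAEDeriv (fun t : ℝ => Real.exp (α * t)) (fun t => α * Real.exp (α * t)) := by
    refine ⟨fun T _ => ?_, Eventually.of_forall fun t => ?_⟩
    · exact ContDiffOn.absolutelyContinuousOnInterval (by fun_prop)
    · simpa [mul_comm] using ((hasDerivAt_id t).const_mul α).exp
  rw [Metric.tendsto_atTop]
  intro ε hε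
  have hk' : ∀ᶠ t in atTop, k t < α * (ε / 2) := hk.eventually_lt_const (by positivity)
  obtain ⟨T, hT⟩ := eventually_atTop.1 hk'
  set T₀ := max T 0
  have hd := (hexp.mul (h.sub (const (ε / 2))))
  -- Past `T₀` the input satisfies `k < α ε/2`, so `V' ≤ -α (V - ε/2)` and the integrating factor
  -- makes the product nonincreasing.
  have hdec : ∀ t, T₀ ≤ t →
      Real.exp (α * t) * (V t - ε / 2) ≤ Real.exp (α * T₀) * (V T₀ - ε / 2) := by
    intro t ht
    refine hd.antitone (le_max_right _ _) ht ?_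
    filter_upwards [hV] with s hs hs'
    have h1 := hT s ((le_max_left _ _).trans hs')
    have h2 : α * Real.exp (α * s) * (V s - ε / 2) + Real.exp (α * s) * (V' s - 0)
        = Real.exp (α * s) * (α * (V s - ε / 2) + V' s) := by ring
    rw [h2]
    exact mul_nonpos_of_nonneg_of_nonpos (Real.exp_pos _).le (by linarith)
  have hlim : Tendsto (fun t : ℝ => Real.exp (-(α * t)) * (Real.exp (α * T₀) * (V T₀ - ε / 2)))
      atTop (𝓝 0) := by
    have : Tendsto (fun t : ℝ => Real.exp (-(α * t))) atTop (𝓝 0) :=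
      Real.tendsto_exp_neg_atTop_nhds_zero.comp (tendsto_id.const_mul_atTop hα)
    simpa using this.mul_const (Real.exp (α * T₀) * (V T₀ - ε / 2))
  obtain ⟨T₁, hT₁⟩ := eventually_atTop.1
    (hlim.eventually_lt_const (show (0 : ℝ) < ε / 2 by positivity))
  refine ⟨max T₀ T₁, fun t ht => ?_⟩
  have h1 := hdec t ((le_max_left _ _).trans ht)
  have h2 := hT₁ t ((le_max_right _ _).trans ht)
  have h3 := mul_le_mul_of_nonneg_left h1 (Real.exp_pos (-(α * t))).le
  rw [← mul_assoc, ← Real.exp_add, neg_add_cancel, Real.exp_zero, one_mul] at h3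
  rw [Real.dist_eq, sub_zero, abs_of_nonneg (h0 t)]
  linarith

/-- Solutions of `ẏ = l y + f` with `Re l < 0` and `f → 0` converge to `0`. -/
theorem tendsto_zero_of_re_neg {y f : ℝ → ℂ} {l : ℂ} (hl : l.re < 0)
    (h : HasAEDeriv y (fun t => l * y t + f t)) (hf : Tendsto f atTop (𝓝 0)) :
    Tendsto y atTop (𝓝 0) := by
  have hre := h.clm_comp Complex.reCLM
  have him := h.clm_comp Complex.imCLM
  have hV := (hre.mul hre).add (him.mul him)
  have hk : Tendsto (fun t => (-l.re)⁻¹ * ‖f t‖ ^ 2) atTop (𝓝 0) := by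
    have := (hf.norm.pow 2).const_mul (-l.re)⁻¹
    simpa using this
  have key := hV.tendsto_zero (fun t => add_nonneg (mul_self_nonneg _) (mul_self_nonneg _))
    (α := -l.re) (by linarith) hk (Eventually.of_forall fun t => by
      have h1 : ‖f t‖ ^ 2 = (f t).re * (f t).re + (f t).im * (f t).im := by
        rw [← Complex.normSq_eq_norm_sq, Complex.normSq_apply]
      set a := -l.re with ha
      have ha0 : 0 < a := by linarith
      have hl' : l.re = -a := by linarith
      -- Young's inequality: half of the damping `2a|y|²` absorbs the cross term with `f`.
      have hinv : ∀ u v : ℝ, 2 * u * v ≤ a * (u * u) + a⁻¹ * (v * v) := by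
        intro u v
        have h2 := mul_nonneg (inv_pos.2 ha0).le (sq_nonneg (a * u - v))
        have h3 : a⁻¹ * (a * u - v) ^ 2 = a * (u * u) * (a⁻¹ * a) + a⁻¹ * (v * v)
            - 2 * u * v * (a⁻¹ * a) := by ring
        rw [h3, inv_mul_cancel₀ ha0.ne'] at h2
        linarith
      have h4 := hinv (y t).re (f t).re
      have h5 := hinv (y t).im (f t).im
      rw [h1]
      simp only [Complex.reCLM_apply, Complex.imCLM_apply, Complex.add_re, Complex.mul_re,
        Complex.add_im, Complex.mul_im, hl']
      nlinarith)
  rw [tendsto_zero_iff_norm_tendsto_zero]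
  have h6 := key.sqrt
  simp only [Real.sqrt_zero] at h6
  refine h6.congr fun t => ?_
  rw [Complex.norm_def, Complex.normSq_apply]
  rfl

end HasAEDeriv

/-! ### Quadratic forms and linear systems -/

section

variable {ι κ : Type*} [Fintype ι] [Fintype κ]

theorem dotProduct_mulVec_pos {Q : Matrix ι ι ℝ} (hQ : Q.PosDef) {y : ι → ℝ} (hy : y ≠ 0) :
    0 < y ⬝ᵥ Q *ᵥ y := by
  simpa using hQ.dotProduct_mulVec_pos hy

theorem dotProduct_mulVec_nonneg {Q : Matrix ι ι ℝ} (hQ : Q.PosDef) (y : ι → ℝ) :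
    0 ≤ y ⬝ᵥ Q *ᵥ y := by
  by_cases hy : y = 0
  · simp [hy]
  · exact (dotProduct_mulVec_pos hQ hy).le

/-- Any two positive definite quadratic forms are comparable. -/
theorem exists_mul_dotProduct_mulVec_le {Q S : Matrix ι ι ℝ} (hQ : Q.PosDef) (hS : S.PosDef) :
    ∃ a : ℝ, 0 < a ∧ ∀ y : ι → ℝ, a * (y ⬝ᵥ S *ᵥ y) ≤ y ⬝ᵥ Q *ᵥ y := by
  have hcont : ∀ X : Matrix ι ι ℝ, Continuous fun y : ι → ℝ => y ⬝ᵥ X *ᵥ y := fun X =>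
    continuous_id.dotProduct (continuous_const.matrix_mulVec continuous_id)
  have hne : ∀ y ∈ Metric.sphere (0 : ι → ℝ) 1, y ≠ 0 := fun y hy h => by simp [h] at hy
  -- The sphere is empty exactly when `ι` is; otherwise the constant is the minimum over it of the
  -- ratio of the two forms.
  rcases (Metric.sphere (0 : ι → ℝ) 1).eq_empty_or_nonempty with hE | hE
  · refine ⟨1, one_pos, fun y => ?_⟩
    have hy : y = 0 := by
      by_contra hy
      have : ‖y‖⁻¹ • y ∈ Metric.sphere (0 : ι → ℝ) 1 := by
        simp [norm_smul, norm_ne_zero_iff.2 hy]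
      simp [hE] at this
    simp [hy]
  · obtain ⟨x, hx, hmin⟩ := (isCompact_sphere (0 : ι → ℝ) 1).exists_isMinOn hE
      (f := fun y => (y ⬝ᵥ Q *ᵥ y) / (y ⬝ᵥ S *ᵥ y))
      ((hcont Q).continuousOn.div (hcont S).continuousOn
        fun y hy => (dotProduct_mulVec_pos hS (hne y hy)).ne')
    refine ⟨(x ⬝ᵥ Q *ᵥ x) / (x ⬝ᵥ S *ᵥ x),
      div_pos (dotProduct_mulVec_pos hQ (hne x hx)) (dotProduct_mulVec_pos hS (hne x hx)),
      fun y => ?_⟩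
    by_cases hy : y = 0
    · simp [hy]
    have hn : ‖y‖ ≠ 0 := norm_ne_zero_iff.2 hy
    have hu : ‖y‖⁻¹ • y ∈ Metric.sphere (0 : ι → ℝ) 1 := by simp [norm_smul, hn]
    have h1 := hmin hu
    simp only [Set.mem_ofPred_eq, Matrix.mulVec_smul, dotProduct_smul, smul_dotProduct,
      smul_eq_mul] at h1
    rw [mul_div_mul_left _ _ (inv_ne_zero hn), mul_div_mul_left _ _ (inv_ne_zero hn)] at h1
    exact (le_div_iff₀ (dotProduct_mulVec_pos hS hy)).1 h1

theorem norm_sq_le_dotProduct (y : ι → ℝ) : ‖y‖ ^ 2 ≤ y ⬝ᵥ y := by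
  have h0 : 0 ≤ y ⬝ᵥ y := Finset.sum_nonneg fun i _ => mul_self_nonneg _
  have h1 : ‖y‖ ≤ √(y ⬝ᵥ y) := (pi_norm_le_iff_of_nonneg (Real.sqrt_nonneg _)).2 fun i => by
    refine Real.le_sqrt_of_sq_le ?_
    rw [Real.norm_eq_abs, sq_abs, sq]
    exact Finset.single_le_sum (f := fun i => y i * y i) (fun i _ => mul_self_nonneg _)
      (Finset.mem_univ i)
  exact (pow_le_pow_left₀ (norm_nonneg y) h1 2).trans_eq (Real.sq_sqrt h0)

theorem abs_dotProduct_le (y w : ι → ℝ) : |y ⬝ᵥ w| ≤ (∑ i, |w i|) * ‖y‖ := by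
  rw [Finset.sum_mul]
  refine (Finset.abs_sum_le_sum_abs _ _).trans (Finset.sum_le_sum fun i _ => ?_)
  rw [abs_mul, mul_comm]
  exact mul_le_mul_of_nonneg_left (norm_le_pi_norm y i) (abs_nonneg _)

/-- Lyapunov's direct method along absolutely continuous functions, with a vanishing
perturbation. -/
theorem HasAEDeriv.tendsto_zero_of_lyapunov [DecidableEq ι] {y y' : ℝ → ι → ℝ}
    (h : HasAEDeriv y y')
    {Q S : Matrix ι ι ℝ} (hQ : Q.PosDef) (hS : S.PosDef) {k : ℝ → ℝ}
    (hk : Tendsto k atTop (𝓝 0))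
    (hd : ∀ᵐ t ∂(volume.restrict (Set.Ici (0 : ℝ))),
      2 * ((S *ᵥ y t) ⬝ᵥ y' t) ≤ -(y t ⬝ᵥ Q *ᵥ y t) + k t * ‖y t‖) :
    Tendsto y atTop (𝓝 0) := by
  obtain ⟨a, ha, hQS⟩ := exists_mul_dotProduct_mulVec_le hQ hS
  obtain ⟨b, hb, hQ1⟩ := exists_mul_dotProduct_mulVec_le hQ Matrix.PosDef.one
  obtain ⟨c, hc, hS1⟩ := exists_mul_dotProduct_mulVec_le hS Matrix.PosDef.one
  simp only [Matrix.one_mulVec] at hQ1 hS1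
  have hk2 : Tendsto (fun t => (2 * b)⁻¹ * k t ^ 2) atTop (𝓝 0) := by
    simpa using (hk.pow 2).const_mul (2 * b)⁻¹
  -- Half of the `Q`-decay yields the rate `a/2`; the other half, at least `b/2 ‖y‖²`, pays for `k
  -- ‖y‖` by Young's inequality.
  have hV := (h.dotProduct_mulVec hS.isHermitian).tendsto_zero
    (fun t => dotProduct_mulVec_nonneg hS _) (half_pos ha) hk2 (by
      filter_upwards [hd] with t ht
      have h1 := hQS (y t)
      have h2 := hQ1 (y t)
      have h3 := norm_sq_le_dotProduct (y t)
      have h4 : k t * ‖y t‖ ≤ b / 2 * ‖y t‖ ^ 2 + (2 * b)⁻¹ * k t ^ 2 := by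
        have h5 : 0 ≤ (2 * b)⁻¹ * (b * ‖y t‖ - k t) ^ 2 := by positivity
        have h6 : (2 * b)⁻¹ * (b * ‖y t‖ - k t) ^ 2
            = b / 2 * ‖y t‖ ^ 2 + (2 * b)⁻¹ * k t ^ 2 - k t * ‖y t‖ := by
          field_simp; ring
        linarith
      have h7 := mul_le_mul_of_nonneg_left h3 hb.le
      linarith)
  have hlim : Tendsto (fun t => √(c⁻¹ * (y t ⬝ᵥ S *ᵥ y t))) atTop (𝓝 0) := by
    simpa using (hV.const_mul c⁻¹).sqrt
  refine squeeze_zero_norm (fun t => ?_) hlim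
  refine Real.le_sqrt_of_sq_le ((norm_sq_le_dotProduct _).trans ?_)
  rw [← div_eq_inv_mul, le_div_iff₀ hc, mul_comm]
  exact hS1 _

/-- The quadratic form of `-(AᵀS + SA - 2GᵀG)`. -/
theorem dotProduct_lmi_mulVec {A S : Matrix ι ι ℝ} (hS : S.IsHermitian) (G : Matrix κ ι ℝ)
    (y : ι → ℝ) :
    y ⬝ᵥ (-(Aᵀ * S + S * A - (2 : ℝ) • (Gᵀ * G))) *ᵥ y
      = -(2 * ((S *ᵥ y) ⬝ᵥ (A *ᵥ y))) + 2 * ((G *ᵥ y) ⬝ᵥ (G *ᵥ y)) := by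
  have hS' : Sᵀ = S := by simpa [Matrix.IsHermitian] using hS
  have h1 : y ⬝ᵥ (Aᵀ * S) *ᵥ y = (S *ᵥ y) ⬝ᵥ (A *ᵥ y) := by
    rw [← Matrix.mulVec_mulVec, Matrix.dotProduct_mulVec, Matrix.vecMul_transpose, dotProduct_comm]
  have h2 : y ⬝ᵥ (S * A) *ᵥ y = (S *ᵥ y) ⬝ᵥ (A *ᵥ y) := by
    rw [← Matrix.mulVec_mulVec, Matrix.dotProduct_mulVec, ← Matrix.mulVec_transpose, hS']
  have h3 : y ⬝ᵥ (Gᵀ * G) *ᵥ y = (G *ᵥ y) ⬝ᵥ (G *ᵥ y) := by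
    rw [← Matrix.mulVec_mulVec, Matrix.dotProduct_mulVec, Matrix.vecMul_transpose]
  rw [Matrix.neg_mulVec, Matrix.sub_mulVec, Matrix.add_mulVec, Matrix.smul_mulVec,
    dotProduct_neg, dotProduct_sub, dotProduct_add, dotProduct_smul, h1, h2, h3, smul_eq_mul]
  ring

/-- The estimation error of an observer with gain `L = -H⁻¹Cᵀ` vanishes. -/
theorem HasAEDeriv.tendsto_zero_of_observer [DecidableEq ι] {A H : Matrix ι ι ℝ}
    {C : Matrix κ ι ℝ} {L : Matrix ι κ ℝ} (hH : H.PosDef)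
    (hHlmi : (-(Aᵀ * H + H * A - (2 : ℝ) • (Cᵀ * C))).PosDef) (hL : L = -(H⁻¹ * Cᵀ))
    {c : ℝ} (hc : 1 ≤ c) {y : ℝ → ι → ℝ}
    (h : HasAEDeriv y (fun t => A *ᵥ y t + c • (L *ᵥ (C *ᵥ y t)))) : Tendsto y atTop (𝓝 0) := by
  refine h.tendsto_zero_of_lyapunov hHlmi hH (tendsto_const_nhds (x := (0 : ℝ)))
    (Eventually.of_forall fun t => ?_)
  have hu : IsUnit H.det := (Matrix.isUnit_iff_isUnit_det _).1 hH.isUnit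
  have hH' : Hᵀ = H := by simpa [Matrix.IsHermitian] using hH.isHermitian
  have h1 : (H *ᵥ y t) ⬝ᵥ (L *ᵥ (C *ᵥ y t)) = -((C *ᵥ y t) ⬝ᵥ (C *ᵥ y t)) := by
    have : H * L = -Cᵀ := by rw [hL, Matrix.mul_neg, Matrix.mul_nonsing_inv_cancel_left _ _ hu]
    rw [Matrix.dotProduct_mulVec, ← Matrix.mulVec_transpose L, Matrix.mulVec_mulVec]
    have h2 : Lᵀ * H = -C := by
      have := congrArg Matrix.transpose this
      simpa [Matrix.transpose_mul, hH'] using this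
    rw [h2, Matrix.neg_mulVec, neg_dotProduct]
  rw [dotProduct_lmi_mulVec hH.isHermitian, dotProduct_add, dotProduct_smul, h1, smul_eq_mul]
  -- The injection gives `-2c|Cy|²`, which for `c ≥ 1` is at most the `-2|Cy|²` the matrix
  -- inequality asks for.
  have h3 : 0 ≤ (C *ᵥ y t) ⬝ᵥ (C *ᵥ y t) := Finset.sum_nonneg fun i _ => mul_self_nonneg _
  nlinarith

end

/-! ### Hurwitz matrices -/

theorem tendsto_mulVec_zero {m n : Type*} [Fintype m] [Fintype n] {𝕜 : Type*} [NormedField 𝕜]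
    (X : Matrix m n 𝕜) {f : ℝ → n → 𝕜}
    (hf : Tendsto f atTop (𝓝 0)) : Tendsto (fun t => X *ᵥ f t) atTop (𝓝 0) := by
  have hc : Continuous fun v : n → 𝕜 => X *ᵥ v := continuous_const.matrix_mulVec continuous_id
  simpa [Function.comp_def] using (hc.tendsto 0).comp hf

section

variable {n : Type*} [Fintype n] [DecidableEq n]

/-- Factors are peeled off one at a time. If `Q` is the product without `X - μ`, then `Q` commutes
with `X`, so `(Qy)' = μ Qy + ((X - μ)Qy + Qf)`. The bracket tends to 0, so each coordinate of `Qy`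
does too, by the scalar case. This replaces Jordan forms and matrix exponentials. -/
theorem HasAEDeriv.tendsto_zero_of_prod_mulVec (X : Matrix n n ℂ) (l : List ℂ)
    (hl : ∀ μ ∈ l, μ.re < 0) {y f : ℝ → n → ℂ} (h : HasAEDeriv y (fun t => X *ᵥ y t + f t))
    (hf : Tendsto f atTop (𝓝 0))
    (hp : Tendsto (fun t => (l.map fun μ => X - Matrix.scalar n μ).prod *ᵥ y t) atTop (𝓝 0)) :
    Tendsto y atTop (𝓝 0) := by
  induction l with
  | nil => simpa using hp
  | cons μ l ih =>
    refine ih (fun ν hν => hl ν (List.mem_cons_of_mem _ hν)) ?_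
    set Q := (l.map fun μ => X - Matrix.scalar n μ).prod with hQ
    have hcomm : Q * X = X * Q := by
      refine (Commute.list_prod_left _ _ fun Z hZ => ?_)
      obtain ⟨ν, -, rfl⟩ := List.mem_map.1 hZ
      exact (Commute.refl X).sub_left (Matrix.scalar_commute ν (fun _ => Commute.all _ _) X)
    rw [tendsto_pi_nhds]
    intro i
    have hd : HasAEDeriv (fun t => (Q *ᵥ y t) i) (fun t => (Q *ᵥ (X *ᵥ y t + f t)) i) :=
      h.linear_comp ((LinearMap.proj i).comp (Q.mulVecLin.restrictScalars ℝ))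
    refine HasAEDeriv.tendsto_zero_of_re_neg (hl μ List.mem_cons_self)
      (f := fun t => (((X - Matrix.scalar n μ) * Q) *ᵥ y t + Q *ᵥ f t) i)
      (hd.congr (Eventually.of_forall fun t => ?_)) ?_
    · have : (Matrix.scalar n μ * Q) *ᵥ y t = μ • (Q *ᵥ y t) := by
        rw [← Matrix.mulVec_mulVec]; ext j; simp [Matrix.mulVec_diagonal]
      rw [Matrix.mulVec_add, Matrix.mulVec_mulVec, hcomm, sub_mul, Matrix.sub_mulVec, this]
      simp only [Pi.add_apply, Pi.sub_apply, Pi.smul_apply, smul_eq_mul]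
      ring
    · have h2 := hp.add (tendsto_mulVec_zero Q hf)
      rw [List.map_cons, List.prod_cons, ← hQ, add_zero] at h2
      exact (tendsto_pi_nhds.1 h2) i

/-- Solutions of `ẏ = X y + f` with `X` Hurwitz and `f → 0` converge to `0`. -/
theorem HasAEDeriv.tendsto_zero_of_isHurwitz {X : Matrix n n ℝ} (hX : IsHurwitz X)
    {y f : ℝ → n → ℝ} (h : HasAEDeriv y (fun t => X *ᵥ y t + f t))
    (hf : Tendsto f atTop (𝓝 0)) : Tendsto y atTop (𝓝 0) := by
  set Xc := X.map Complex.ofReal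
  let toC : (n → ℝ) →ₗ[ℝ] (n → ℂ) := Complex.ofRealLI.toLinearMap.compLeft n
  have htoC : ∀ v i, toC v i = (v i : ℂ) := fun v i => rfl
  have hmul : ∀ v, toC (X *ᵥ v) = Xc *ᵥ toC v := by
    intro v; ext i
    simp [htoC, Xc, Matrix.mulVec, dotProduct]
  have hyc : HasAEDeriv (fun t => toC (y t)) (fun t => Xc *ᵥ toC (y t) + toC (f t)) :=
    (h.linear_comp toC).congr (Eventually.of_forall fun t => by rw [map_add, hmul])
  have hcont : Continuous toC := toC.continuous_of_finiteDimensional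
  have hfc : Tendsto (fun t => toC (f t)) atTop (𝓝 0) := by
    simpa [Function.comp_def] using (hcont.tendsto 0).comp hf
  -- Cayley–Hamilton over `ℂ` starts the induction: the full product over the eigenvalues is zero.
  have hprod : (Xc.charpoly.roots.toList.map fun μ => Xc - Matrix.scalar n μ).prod = 0 := by
    have h1 : Xc.charpoly = (Xc.charpoly.roots.toList.map
        fun μ => Polynomial.X - Polynomial.C μ).prod := by
      have h2 := (IsAlgClosed.splits Xc.charpoly).eq_prod_roots_of_monic Xc.charpoly_monic
      conv_lhs => rw [h2]
      rw [← Multiset.prod_coe, ← Multiset.map_coe, Multiset.coe_toList]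
    have h3 := Matrix.aeval_self_charpoly Xc
    rw [h1, map_list_prod, List.map_map] at h3
    rw [← h3]
    refine congrArg (fun g => (Xc.charpoly.roots.toList.map g).prod) (funext fun μ => ?_)
    simp [Matrix.algebraMap_eq_diagonal, Pi.algebraMap_def]
  have key := hyc.tendsto_zero_of_prod_mulVec Xc Xc.charpoly.roots.toList (fun μ hμ => ?_) hfc
    (by simp only [hprod, Matrix.zero_mulVec, tendsto_const_nhds])
  · rw [tendsto_pi_nhds] at key ⊢
    intro i
    have := (Complex.continuous_re.tendsto _).comp (key i)
    simpa [Function.comp_def, htoC] using this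
  · refine hX μ (Matrix.mem_spectrum_iff_isRoot_charpoly.2 ?_)
    rw [Multiset.mem_toList] at hμ
    exact Polynomial.isRoot_of_mem_roots hμ

end

/-! ### Continuous functionals of a Filippov set -/

/-- Filippov balls and the trajectory bounds are Euclidean, while the norm on `ι → ℝ` is the sup
norm. -/
theorem norm_le_norm2 {ι : Type*} [Fintype ι] (v : ι → ℝ) : ‖v‖ ≤ norm2 v := by
  refine (pi_norm_le_iff_of_nonneg (norm_nonneg _)).2 fun i => ?_
  exact PiLp.norm_apply_le (WithLp.toLp 2 v) i

/-- A linear functional whose composition with the field is continuous at `x` takes a single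
value on the Filippov set at `x`. -/
theorem linear_eq_of_mem_filippovMap {ι : Type*} [Fintype ι] {f : (ι → ℝ) → ℝ → ι → ℝ}
    {x v : ι → ℝ} {t : ℝ} (hv : v ∈ filippovMap f x t) (φ : (ι → ℝ) →ₗ[ℝ] ℝ)
    (hφ : ContinuousAt (fun y => φ (f y t)) x) : φ v = φ (f x t) := by
  refine eq_of_forall_dist_le fun ε hε => ?_
  obtain ⟨δ, hδ, hb⟩ := Metric.continuousAt_iff.1 hφ ε hε
  have hv' := hv
  simp only [filippovMap, Set.mem_iInter] at hv'
  -- The null set `∅` suffices: near `x` the values of `φ ∘ f` lie in a small ball, whose preimage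
  -- under `φ` is closed and convex.
  have hmem := hv' δ hδ ∅ measure_empty
  have hcont : Continuous φ := φ.continuous_of_finiteDimensional
  have hsub : closedConvexHull ℝ ((fun y => f y t) '' ({y | norm2 (y - x) < δ} \ ∅))
      ⊆ φ ⁻¹' Metric.closedBall (φ (f x t)) ε := by
    refine closedConvexHull_min ?_ ((convex_closedBall _ _).linear_preimage φ)
      (Metric.isClosed_closedBall.preimage hcont)
    rintro _ ⟨y, ⟨hy, -⟩, rfl⟩
    refine (hb ?_).le
    rw [dist_eq_norm]
    exact (norm_le_norm2 _).trans_lt hy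
  exact hsub hmem

/-! ### The leaders -/

section

theorem HasAEDeriv.pi {ι : Type*} [Fintype ι] {y y' : ℝ → ι → ℝ}
    (h : ∀ i, HasAEDeriv (fun t => y t i) (fun t => y' t i)) : HasAEDeriv y y' := by
  classical
  have h1 := HasAEDeriv.sum Finset.univ fun i => (h i).linear_comp (LinearMap.single ℝ (fun _ => ℝ) i)
  have h2 : ∀ v : ι → ℝ, ∑ i, LinearMap.single ℝ (fun _ => ℝ) i (v i) = v := fun v => by
    simp [Finset.univ_sum_single]
  simpa only [h2] using h1

theorem IsCaratheodorySolution.hasAEDeriv {ι : Type*} [Fintype ι]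
    {f : (ι → ℝ) → ℝ → (ι → ℝ)} {x : ℝ → (ι → ℝ)} (h : IsCaratheodorySolution f x) :
    HasAEDeriv x (fun t => f (x t) t) :=
  ⟨fun T hT => (h T hT).1, ae_restrict_Ici_of_forall_Icc fun T hT => (h T hT).2⟩

theorem IsFilippovSolution.hasAEDeriv {ι : Type*} [Fintype ι]
    {f : (ι → ℝ) → ℝ → (ι → ℝ)} {x : ℝ → (ι → ℝ)} (h : IsFilippovSolution f x) :
    HasAEDeriv x (deriv x) := by
  refine ⟨fun T hT => (h T hT).1, ae_restrict_Ici_of_forall_Icc fun T hT => ?_⟩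
  filter_upwards [(h T hT).2] with t ⟨v, _, hv⟩
  exact hv.deriv.symm ▸ hv

theorem IsFilippovSolution.ae_deriv_mem {ι : Type*} [Fintype ι]
    {f : (ι → ℝ) → ℝ → (ι → ℝ)} {x : ℝ → (ι → ℝ)} (h : IsFilippovSolution f x) :
    ∀ᵐ t ∂(volume.restrict (Set.Ici (0 : ℝ))), deriv x t ∈ filippovMap f (x t) t := by
  refine ae_restrict_Ici_of_forall_Icc fun T hT => ?_
  filter_upwards [(h T hT).2] with t ⟨v, hm, hv⟩
  exact hv.deriv.symm ▸ hm

variable {m q nl nf : ℕ}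

theorem kronecker_one_mulVec_apply {ι κ α : Type*} [Fintype κ] [Fintype α] [DecidableEq α]
    (X : Matrix ι κ ℝ) (v : κ × α → ℝ) (i : ι) (a : α) :
    ((X ⊗ₖ (1 : Matrix α α ℝ)) *ᵥ v) (i, a) = (X *ᵥ fun k => v (k, a)) i := by
  simp [Matrix.mulVec, dotProduct, Fintype.sum_prod_type, Matrix.one_apply]

theorem sysB_mulVec_apply (u : Fin 3 → ℝ) (k : Fin m) (a : Fin 3) :
    (sysB m *ᵥ u) (k, a) = if (k : ℕ) + 1 = m then u a else 0 := by
  by_cases h : (k : ℕ) + 1 = m <;> simp [sysB, Matrix.mulVec, dotProduct, h]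

theorem hasAEDeriv_trajDeriv {γ : ℕ → ℝ} {p : ℝ → Fin 3 → ℝ} (hp : BoundedDerivs m γ p) {k : ℕ}
    (hk : k < m) : HasAEDeriv (trajDeriv k p) (trajDeriv (k + 1) p) := by
  have hd : ∀ t ∈ Set.Ici (0 : ℝ),
      HasDerivWithinAt (trajDeriv k p) (trajDeriv (k + 1) p t) (Set.Ici 0) t := fun t ht => by
    have := ((hp.1 k hk) t ht).hasDerivWithinAt
    rwa [trajDeriv, ← iteratedDerivWithin_succ] at this
  -- The bound on the next derivative gives a Lipschitz constant, hence absolute continuity without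
  -- continuity of the top derivative.
  have hlip := (convex_Ici (0 : ℝ)).lipschitzOnWith_of_nnnorm_hasDerivWithin_le
    (C := (γ (k + 1)).toNNReal) hd fun t ht => by
      rw [← NNReal.coe_le_coe, coe_nnnorm]
      exact ((norm_le_norm2 _).trans (hp.2 (k + 1) (by omega) (by omega) t ht)).trans
        (Real.le_coe_toNNReal _)
  refine ⟨fun T hT => (hlip.mono ?_).absolutelyContinuousOnInterval, ?_⟩
  · rw [Set.uIcc_of_le hT.le]; exact Set.Icc_subset_Ici_self
  -- At `t = 0` the derivative is only one-sided; that point is null.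
  · rw [← restrict_Ioi_eq_restrict_Ici]
    filter_upwards [ae_restrict_mem measurableSet_Ioi] with t ht
    exact (hd t (Set.mem_Ioi.1 ht).le).hasDerivAt (Ici_mem_nhds ht)

/-- This is `ẋ* = A x* + B p*⁽ᵐ⁾` in coordinates; the last row of the shift is zero, so there only
the input term remains. -/
theorem trajDeriv_succ_eq (p : ℝ → Fin 3 → ℝ) (t : ℝ) (k : Fin m) (a : Fin 3) :
    trajDeriv (k + 1) p t a = (shift m *ᵥ fun k' : Fin m => trajDeriv k' p t a) k
      + if (k : ℕ) + 1 = m then trajDeriv m p t a else 0 := by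
  by_cases h : (k : ℕ) + 1 = m
  · have h0 : (shift m *ᵥ fun k' : Fin m => trajDeriv k' p t a) k = 0 := by
      change ∑ j : Fin m, shift m k j * trajDeriv j p t a = 0
      refine Finset.sum_eq_zero fun j _ => ?_
      have : (j : ℕ) ≠ k + 1 := by omega
      simp [shift, this]
    rw [h0, if_pos h, zero_add, h]
  · have h1 : (k : ℕ) + 1 < m := by omega
    have h2 : (shift m *ᵥ fun k' : Fin m => trajDeriv k' p t a) k = trajDeriv (k + 1) p t a := by
      change ∑ j : Fin m, shift m k j * trajDeriv j p t a = _
      refine (Finset.sum_eq_single (⟨k + 1, h1⟩ : Fin m) (fun j _ hj => ?_) (by simp)).trans ?_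
      · have : (j : ℕ) ≠ k + 1 := fun h => hj (Fin.ext h)
        simp [shift, this]
      · simp [shift]
    rw [h2, if_neg h, add_zero]

theorem leaderField_stX (C : Matrix (Fin q) (St m) ℝ) (L : Matrix (St m) (Fin q) ℝ)
    (β : Fin m → ℝ) (p : Fin nl → ℝ → Fin 3 → ℝ) (z : Fin nl × Zt m → ℝ) (t : ℝ) (j : Fin nl) :
    stX (leaderField C L β p z t) j
      = sysA m *ᵥ stX z j + sysB m *ᵥ leaderInput β p z t j := rfl

theorem leaderField_stE (C : Matrix (Fin q) (St m) ℝ) (L : Matrix (St m) (Fin q) ℝ)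
    (β : Fin m → ℝ) (p : Fin nl → ℝ → Fin 3 → ℝ) (z : Fin nl × Zt m → ℝ) (t : ℝ) (j : Fin nl) :
    stE (leaderField C L β p z t) j
      = sysA m *ᵥ stE z j + sysB m *ᵥ leaderInput β p z t j
        + L *ᵥ (C *ᵥ stE z j - C *ᵥ stX z j) := rfl

theorem HasAEDeriv.stX {n : ℕ} {z z' : ℝ → Fin n × Zt m → ℝ} (h : HasAEDeriv z z') (i : Fin n) :
    HasAEDeriv (fun t => stX (z t) i) (fun t => stX (z' t) i) :=
  h.linear_comp (LinearMap.funLeft ℝ ℝ fun s : St m => (i, (Sum.inl s : Zt m)))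

theorem HasAEDeriv.stE {n : ℕ} {z z' : ℝ → Fin n × Zt m → ℝ} (h : HasAEDeriv z z') (i : Fin n) :
    HasAEDeriv (fun t => stE (z t) i) (fun t => stE (z' t) i) :=
  h.linear_comp (LinearMap.funLeft ℝ ℝ fun s : St m => (i, (Sum.inr s : Zt m)))

variable {γ : ℕ → ℝ} {p : Fin nl → ℝ → Fin 3 → ℝ} {C : Matrix (Fin q) (St m) ℝ}
  {H : Matrix (St m) (St m) ℝ} {L : Matrix (St m) (Fin q) ℝ} {β : Fin m → ℝ}
  {zl : ℝ → Fin nl × Zt m → ℝ}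

/-- The feedback part of the leader inputs vanishes asymptotically. -/
theorem tendsto_leaderInput_sub (hp : ∀ i, BoundedDerivs m γ (p i))
    (hH : H.PosDef) (hHlmi : (-((sysA m)ᵀ * H + H * sysA m - (2 : ℝ) • (Cᵀ * C))).PosDef)
    (hL : L = -(H⁻¹ * Cᵀ)) (hβ : IsHurwitz (W₁ β))
    (hzl : HasAEDeriv zl (fun t => leaderField C L β p (zl t) t)) (j : Fin nl) (a : Fin 3) :
    Tendsto (fun t => leaderInput β p (zl t) t j a - trajDeriv m (p j) t a) atTop (𝓝 0) := by
  have hδ : Tendsto (fun t => stE (zl t) j - stX (zl t) j) atTop (𝓝 0) := by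
    refine HasAEDeriv.tendsto_zero_of_observer hH hHlmi hL le_rfl
      (((hzl.stE j).sub (hzl.stX j)).congr (Eventually.of_forall fun t => ?_))
    rw [leaderField_stX, leaderField_stE, one_smul, ← Matrix.mulVec_sub, Matrix.mulVec_sub (sysA m)]
    abel
  have hδa : Tendsto (fun t (k : Fin m) => (stE (zl t) j - stX (zl t) j) (k, a)) atTop (𝓝 0) :=
    tendsto_pi_nhds.2 fun k => (tendsto_pi_nhds.1 hδ) (k, a)
  -- The factor `I₃` lets each spatial coordinate `a` be treated alone: the tracking error obeys `ẏ
  -- = W₁ y + W₂ δ` with the vanishing estimation error `δ` as forcing. The feedback is then `β · (y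
  -- + δ)`.
  have hy : HasAEDeriv (fun t (k : Fin m) => stX (zl t) j (k, a) - trajDeriv k (p j) t a)
      (fun t => W₁ β *ᵥ (fun k : Fin m => stX (zl t) j (k, a) - trajDeriv k (p j) t a)
        + W₂ β *ᵥ fun k => (stE (zl t) j - stX (zl t) j) (k, a)) := by
    refine HasAEDeriv.pi fun k => ?_
    refine (((hzl.stX j).linear_comp (LinearMap.proj (k, a))).sub
      ((hasAEDeriv_trajDeriv (hp j) k.2).linear_comp (LinearMap.proj a))).congr
        (Eventually.of_forall fun t => ?_)
    have hW2 : ∀ v : Fin m → ℝ, (W₂ β *ᵥ v) k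
        = if (k : ℕ) + 1 = m then ∑ k', β k' * v k' else 0 := fun v => by
      by_cases h : (k : ℕ) + 1 = m <;> simp [W₂, Matrix.mulVec, dotProduct, h]
    have hsub : (shift m *ᵥ fun k : Fin m => stX (zl t) j (k, a) - trajDeriv k (p j) t a)
        = (shift m *ᵥ fun k : Fin m => stX (zl t) j (k, a))
          - shift m *ᵥ fun k : Fin m => trajDeriv k (p j) t a := by
      rw [← Matrix.mulVec_sub]; rfl
    simp only [LinearMap.proj_apply]
    rw [leaderField_stX, trajDeriv_succ_eq, Pi.add_apply, sysB_mulVec_apply, sysA,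
      kronecker_one_mulVec_apply, Pi.add_apply, W₁, Matrix.add_mulVec, Pi.add_apply, hW2, hW2,
      hsub, Pi.sub_apply]
    by_cases h : (k : ℕ) + 1 = m
    · simp only [if_pos h, leaderInput, desiredState, Pi.sub_apply]
      have : ∑ k, β k * (stE (zl t) j (k, a) - trajDeriv k (p j) t a)
          = ∑ k', β k' * (stX (zl t) j (k', a) - trajDeriv k' (p j) t a)
            + ∑ k', β k' * (stE (zl t) j (k', a) - stX (zl t) j (k', a)) := by
        rw [← Finset.sum_add_distrib]
        exact Finset.sum_congr rfl fun _ _ => by ring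
      rw [this]; ring
    · simp only [if_neg h]; ring
  have hy0 := hy.tendsto_zero_of_isHurwitz hβ (tendsto_mulVec_zero (W₂ β) hδa)
  have hsum := tendsto_finsetSum Finset.univ fun (k : Fin m) _ =>
    (((tendsto_pi_nhds.1 hy0) k).add ((tendsto_pi_nhds.1 hδa) k)).const_mul (β k)
  simp only [Pi.zero_apply, add_zero, mul_zero, Finset.sum_const_zero] at hsum
  refine hsum.congr fun t => ?_
  simp only [leaderInput, desiredState, add_sub_cancel_right, Pi.sub_apply]
  exact Finset.sum_congr rfl fun _ _ => by ring

open scoped Matrix.Norms.L2Operator in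
theorem IsLeaderInputConstant.le {ζ γm γu : ℝ} (h : IsLeaderInputConstant C L β ζ γm γu)
    (hζ : 0 ≤ ζ) : γm ≤ γu := by
  obtain ⟨M, Minv, J, l, -, -, -, -, -, rfl⟩ := h
  have h1 : 0 ≤ psi m l := Real.sqrt_nonneg _
  have h2 : 0 ≤ norm2 β := norm_nonneg _
  have h3 : 0 ≤ 4 * psi m l * ζ * norm2 β * ‖M‖ * ‖Minv‖ := by positivity
  linarith

/-- Up to a vanishing term, `γu` bounds the leader inputs. -/
theorem exists_abs_leaderInput_le (hp : ∀ i, BoundedDerivs m γ (p i)) (hm : 1 ≤ m)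
    (hH : H.PosDef) (hHlmi : (-((sysA m)ᵀ * H + H * sysA m - (2 : ℝ) • (Cᵀ * C))).PosDef)
    (hL : L = -(H⁻¹ * Cᵀ)) (hβ : IsHurwitz (W₁ β))
    (hzl : HasAEDeriv zl (fun t => leaderField C L β p (zl t) t))
    {ζ γu : ℝ} (hζ : ∀ i, norm2 (stE (zl 0) i - stX (zl 0) i) ≤ ζ)
    (hγu : IsLeaderInputConstant C L β ζ (γ m) γu ∨
      ∀ i, ∀ t, 0 ≤ t → norm2 (leaderInput β p (zl t) t i) ≤ γu) :
    ∃ κ : ℝ → ℝ, Tendsto κ atTop (𝓝 0) ∧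
      ∀ t, 0 ≤ t → ∀ j a, |leaderInput β p (zl t) t j a| ≤ γu + κ t := by
  rcases hγu with h | h
  -- Summing over all leaders and coordinates gives one vanishing bound uniform in `j` and `a`.
  · refine ⟨fun t => ∑ j, ∑ a, |leaderInput β p (zl t) t j a - trajDeriv m (p j) t a|, ?_, ?_⟩
    · have := tendsto_finsetSum Finset.univ fun (j : Fin nl) _ =>
        tendsto_finsetSum Finset.univ fun (a : Fin 3) _ =>
          (tendsto_leaderInput_sub hp hH hHlmi hL hβ hzl j a).abs
      simpa using this
    · intro t ht j a
      have h1 : γ m ≤ γu := h.le ((norm_nonneg _).trans (hζ j))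
      have h2 : |trajDeriv m (p j) t a| ≤ γ m :=
        ((norm_le_pi_norm (trajDeriv m (p j) t) a).trans (norm_le_norm2 _)).trans
          ((hp j).2 m hm le_rfl t ht)
      have h3 : |leaderInput β p (zl t) t j a - trajDeriv m (p j) t a|
          ≤ ∑ j, ∑ a, |leaderInput β p (zl t) t j a - trajDeriv m (p j) t a| :=
        (Finset.single_le_sum
          (f := fun a => |leaderInput β p (zl t) t j a - trajDeriv m (p j) t a|)
          (fun _ _ => abs_nonneg _) (Finset.mem_univ a)).trans
        (Finset.single_le_sum
          (f := fun j => ∑ a, |leaderInput β p (zl t) t j a - trajDeriv m (p j) t a|)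
          (fun _ _ => Finset.sum_nonneg fun _ _ => abs_nonneg _) (Finset.mem_univ j))
      have h4 := abs_sub_abs_le_abs_sub (leaderInput β p (zl t) t j a) (trajDeriv m (p j) t a)
      linarith
  · refine ⟨fun _ => 0, tendsto_const_nhds, fun t ht j a => ?_⟩
    rw [add_zero]
    exact ((norm_le_pi_norm (leaderInput β p (zl t) t j) a).trans (norm_le_norm2 _)).trans
      (h j t ht)

end

/-! ### The followers -/

section

variable {m q nl nf : ℕ}

/-! ### Algebra of the normalized follower matrix -/

namespace NominalFormation

variable (F : NominalFormation nl nf)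

theorem followerMatrix_row_sum (i : Fin nf) : ∑ j, F.followerMatrix i j = 0 := by
  classical
  have h : ∀ j, F.followerMatrix i j
      = (if j = Sum.inr i then ∑ k with F.graph.Adj (Sum.inr i) k, F.w i k else 0)
        - if F.graph.Adj (Sum.inr i) j then F.w i j else 0 := by
    intro j
    simp only [followerMatrix, Matrix.of_apply]
    by_cases h1 : j = Sum.inr i
    · have h2 : ¬ F.graph.Adj (Sum.inr i) j := h1 ▸ F.loopless _
      simp only [if_pos h1, if_neg h2, sub_zero]
    · by_cases h2 : F.graph.Adj (Sum.inr i) j <;> simp [h1, h2]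
  rw [Finset.sum_congr rfl fun j _ => h j, Finset.sum_sub_distrib, Finset.sum_ite_eq',
    if_pos (Finset.mem_univ _), Finset.sum_filter, sub_self]

theorem sum_σ_eq_neg_one (hF : F.Localizable) (i : Fin nf) :
    ∑ j, (F.Ωff⁻¹ * F.Ωfl) i j = -1 := by
  have h1 : F.Ωfl *ᵥ (fun _ => 1) = -(F.Ωff *ᵥ fun _ => 1) := by
    ext k
    have := F.followerMatrix_row_sum k
    rw [Fintype.sum_sum_type] at this
    simp only [Matrix.mulVec, dotProduct, Ωfl, Ωff, Matrix.submatrix_apply, id, mul_one,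
      Pi.neg_apply]
    linarith
  have h2 : (F.Ωff⁻¹ * F.Ωfl) *ᵥ (fun _ => 1) = -(fun _ => 1) := by
    rw [← Matrix.mulVec_mulVec, h1, Matrix.mulVec_neg, Matrix.mulVec_mulVec,
      Matrix.nonsing_inv_mul _ hF, Matrix.one_mulVec]
  simpa [Matrix.mulVec, dotProduct] using congrFun h2 i

/-- Decoupling: `Ω_ff⁻¹Ω_ff = I` kills the terms from other followers, and the leader weights
`-σ_ij` sum to 1. The module `V` is general because the identity serves both the estimates and the
output residuals. -/
theorem sum_wbar_smul_sub (hF : F.Localizable) {V : Type*} [AddCommGroup V] [Module ℝ V]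
    (i : Fin nf) (a : Agent nl nf → V) :
    ∑ j, F.wbar i j • (a (Sum.inr i) - a j)
      = a (Sum.inr i) + ∑ j, (F.Ωff⁻¹ * F.Ωfl) i j • a (Sum.inl j) := by
  have hl : ∀ j, F.wbar i (Sum.inl j) = -(F.Ωff⁻¹ * F.Ωfl) i j := fun j => rfl
  have hr : ∀ k, F.wbar i (Sum.inr k) = -(1 : Matrix (Fin nf) (Fin nf) ℝ) i k := fun k => by
    rw [← Matrix.nonsing_inv_mul _ hF]; rfl
  have h0 : ∑ k, F.wbar i (Sum.inr k) • (a (Sum.inr i) - a (Sum.inr k)) = 0 := by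
    refine Finset.sum_eq_zero fun k _ => ?_
    by_cases h : k = i
    · simp [h]
    · simp [hr, Matrix.one_apply_ne (Ne.symm h)]
  rw [Fintype.sum_sum_type, h0, add_zero]
  simp only [hl, neg_smul, smul_sub, Finset.sum_neg_distrib, Finset.sum_sub_distrib]
  rw [← Finset.sum_smul, F.sum_σ_eq_neg_one hF]
  simp

theorem abs_le_σ (i : Fin nf) (j : Fin nl) : |(F.Ωff⁻¹ * F.Ωfl) i j| ≤ F.σ :=
  le_ciSup (f := fun p : Fin nf × Fin nl => |(F.Ωff⁻¹ * F.Ωfl) p.1 p.2|)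
    (Set.finite_range _).bddAbove (i, j)

end NominalFormation

variable (F : NominalFormation nl nf)

theorem stX_followerError (zl : Fin nl × Zt m → ℝ) (zf : Fin nf × Zt m → ℝ) (i : Fin nf) :
    stX (followerError F zl zf) i = stX zf i + ∑ j, (F.Ωff⁻¹ * F.Ωfl) i j • stX zl j := by
  ext s
  simp only [stX, followerError, Pi.add_apply, kronecker_one_mulVec_apply, Finset.sum_apply,
    Pi.smul_apply, smul_eq_mul]
  rfl

theorem stE_followerError (zl : Fin nl × Zt m → ℝ) (zf : Fin nf × Zt m → ℝ) (i : Fin nf) :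
    stE (followerError F zl zf) i = stE zf i + ∑ j, (F.Ωff⁻¹ * F.Ωfl) i j • stE zl j := by
  ext s
  simp only [stE, followerError, Pi.add_apply, kronecker_one_mulVec_apply, Finset.sum_apply,
    Pi.smul_apply, smul_eq_mul]
  rfl

/-! ### The closed loop in error coordinates -/

variable {F} {C : Matrix (Fin q) (St m) ℝ} {K : Matrix (Fin 3) (St m) ℝ}
  {L : Matrix (St m) (Fin q) ℝ} {c₁ c₂ : ℝ}

theorem stX_followerField (hF : F.Localizable) (zl : Fin nl × Zt m → ℝ) (zf : Fin nf × Zt m → ℝ)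
    (i : Fin nf) :
    stX (followerField F C K L c₁ c₂ zl zf) i = sysA m *ᵥ stX zf i
      + sysB m *ᵥ (c₁ • (K *ᵥ stE (followerError F zl zf) i)
        + c₂ • sgn (K *ᵥ stE (followerError F zl zf) i)) := by
  rw [stE_followerError]
  have := F.sum_wbar_smul_sub hF i (Sum.elim (stE zl) (stE zf))
  simp only [Sum.elim_inl, Sum.elim_inr] at this
  rw [← this]
  rfl

theorem stE_followerField (hF : F.Localizable) (zl : Fin nl × Zt m → ℝ) (zf : Fin nf × Zt m → ℝ)
    (i : Fin nf) :
    stE (followerField F C K L c₁ c₂ zl zf) i = sysA m *ᵥ stE zf i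
      + sysB m *ᵥ (c₁ • (K *ᵥ stE (followerError F zl zf) i)
        + c₂ • sgn (K *ᵥ stE (followerError F zl zf) i))
      + L *ᵥ (C *ᵥ (stE zf i - stX zf i))
      + c₁ • (L *ᵥ (C *ᵥ (stE (followerError F zl zf) i - stX (followerError F zl zf) i))) := by
  have h1 := F.sum_wbar_smul_sub hF i (Sum.elim (stE zl) (stE zf))
  have h2 := F.sum_wbar_smul_sub hF i
    (fun j => C *ᵥ (Sum.elim (stE zl) (stE zf) j - Sum.elim (stX zl) (stX zf) j))
  simp only [Sum.elim_inl, Sum.elim_inr] at h1 h2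
  have h3 : C *ᵥ (stE (followerError F zl zf) i - stX (followerError F zl zf) i)
      = ∑ j, F.wbar i j • (C *ᵥ (stE zf i - Sum.elim (stE zl) (stE zf) j)
        - (C *ᵥ stX zf i - C *ᵥ Sum.elim (stX zl) (stX zf) j)) := by
    have h4 : ∀ j, C *ᵥ (stE zf i - Sum.elim (stE zl) (stE zf) j)
        - (C *ᵥ stX zf i - C *ᵥ Sum.elim (stX zl) (stX zf) j)
        = C *ᵥ (stE zf i - stX zf i)
          - C *ᵥ (Sum.elim (stE zl) (stE zf) j - Sum.elim (stX zl) (stX zf) j) := fun j => by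
      simp only [Matrix.mulVec_sub]; abel
    simp only [h4]
    rw [h2, stE_followerError, stX_followerError, add_sub_add_comm, ← Finset.sum_sub_distrib,
      Matrix.mulVec_add, Matrix.mulVec_sum]
    simp only [← smul_sub, Matrix.mulVec_smul]
  rw [h3, stE_followerError, ← h1, Matrix.mulVec_sub]
  rfl

theorem HasAEDeriv.followerError {zl zl' : ℝ → Fin nl × Zt m → ℝ} {zf zf' : ℝ → Fin nf × Zt m → ℝ}
    (hl : HasAEDeriv zl zl') (hf : HasAEDeriv zf zf') :
    HasAEDeriv (fun t => followerError F (zl t) (zf t))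
      (fun t => followerError F (zl' t) (zf' t)) :=
  hf.add (hl.linear_comp
    (Matrix.mulVecLin ((F.Ωff⁻¹ * F.Ωfl) ⊗ₖ (1 : Matrix (Zt m) (Zt m) ℝ))))

variable {p : Fin nl → ℝ → Fin 3 → ℝ} {β : Fin m → ℝ}

/-- The combination of the leader inputs that enters the tracking error of follower `i`. -/
noncomputable def leaderDisturbance (F : NominalFormation nl nf) (β : Fin m → ℝ) (p : Fin nl → ℝ → Fin 3 → ℝ)
    (zl : Fin nl × Zt m → ℝ) (t : ℝ) (i : Fin nf) : Fin 3 → ℝ :=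
  ∑ j, (F.Ωff⁻¹ * F.Ωfl) i j • leaderInput β p zl t j

theorem stX_followerError_field (hF : F.Localizable) (zl : Fin nl × Zt m → ℝ)
    (zf : Fin nf × Zt m → ℝ) (t : ℝ) (i : Fin nf) :
    stX (followerError F (leaderField C L β p zl t) (followerField F C K L c₁ c₂ zl zf)) i
      = sysA m *ᵥ stX (followerError F zl zf) i
        + sysB m *ᵥ (c₁ • (K *ᵥ stE (followerError F zl zf) i)
          + c₂ • sgn (K *ᵥ stE (followerError F zl zf) i) + leaderDisturbance F β p zl t i) := by
  rw [stX_followerError, stX_followerField hF, stX_followerError F zl zf]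
  simp only [leaderField_stX, leaderDisturbance, smul_add, Finset.sum_add_distrib,
    Matrix.mulVec_add, Matrix.mulVec_sum, Matrix.mulVec_smul]
  abel

/-- In the gain `1 + c₁`, the 1 comes from the agents' own observers, leaders' included, combined
with the weights `σ_ij`; `c₁` comes from the coupling term. -/
theorem stE_followerError_field (hF : F.Localizable) (zl : Fin nl × Zt m → ℝ)
    (zf : Fin nf × Zt m → ℝ) (t : ℝ) (i : Fin nf) :
    stE (followerError F (leaderField C L β p zl t) (followerField F C K L c₁ c₂ zl zf)) i
      = sysA m *ᵥ stE (followerError F zl zf) i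
        + sysB m *ᵥ (c₁ • (K *ᵥ stE (followerError F zl zf) i)
          + c₂ • sgn (K *ᵥ stE (followerError F zl zf) i) + leaderDisturbance F β p zl t i)
        + (1 + c₁) • (L *ᵥ (C *ᵥ
          (stE (followerError F zl zf) i - stX (followerError F zl zf) i))) := by
  rw [stE_followerError, stE_followerField hF, add_smul, one_smul]
  have h : L *ᵥ (C *ᵥ (stE (followerError F zl zf) i - stX (followerError F zl zf) i))
      = L *ᵥ (C *ᵥ (stE zf i - stX zf i))
        + ∑ j, (F.Ωff⁻¹ * F.Ωfl) i j • (L *ᵥ (C *ᵥ stE zl j - C *ᵥ stX zl j)) := by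
    rw [stE_followerError, stX_followerError, add_sub_add_comm, ← Finset.sum_sub_distrib]
    simp only [← smul_sub, ← Matrix.mulVec_sub, Matrix.mulVec_add, Matrix.mulVec_sum,
      Matrix.mulVec_smul]
  have hA : sysA m *ᵥ stE (followerError F zl zf) i
      = sysA m *ᵥ stE zf i + ∑ j, (F.Ωff⁻¹ * F.Ωfl) i j • (sysA m *ᵥ stE zl j) := by
    rw [stE_followerError]
    simp only [Matrix.mulVec_add, Matrix.mulVec_sum, Matrix.mulVec_smul]
  rw [hA, h]
  simp only [leaderField_stE, leaderDisturbance, smul_add, Finset.sum_add_distrib,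
    Matrix.mulVec_add, Matrix.mulVec_sum, Matrix.mulVec_smul]
  abel

theorem abs_leaderDisturbance_le {zl : Fin nl × Zt m → ℝ} {t b : ℝ}
    (hb : ∀ j a, |leaderInput β p zl t j a| ≤ b) (i : Fin nf) (a : Fin 3) :
    |leaderDisturbance F β p zl t i a| ≤ nl * F.σ * b := by
  have h : ∀ j ∈ Finset.univ, |(F.Ωff⁻¹ * F.Ωfl) i j * leaderInput β p zl t j a| ≤ F.σ * b := by
    intro j _
    rw [abs_mul]
    exact mul_le_mul (F.abs_le_σ i j) (hb j a) (abs_nonneg _)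
      ((abs_nonneg _).trans (F.abs_le_σ i j))
  have h1 := (Finset.abs_sum_le_sum_abs
    (fun j => (F.Ωff⁻¹ * F.Ωfl) i j * leaderInput β p zl t j a) Finset.univ).trans
      (Finset.sum_le_sum h)
  rw [Finset.sum_const, Finset.card_univ, Fintype.card_fin, nsmul_eq_mul, ← mul_assoc] at h1
  simpa [leaderDisturbance, Finset.sum_apply] using h1

end

/-! ### Convergence of the tracking errors -/

section

variable {m q nl nf : ℕ} {F : NominalFormation nl nf} {C : Matrix (Fin q) (St m) ℝ}
  {K : Matrix (Fin 3) (St m) ℝ} {L : Matrix (St m) (Fin q) ℝ} {c₁ c₂ : ℝ}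
  {p : Fin nl → ℝ → Fin 3 → ℝ} {β : Fin m → ℝ} {P H : Matrix (St m) (St m) ℝ}
  {zl : ℝ → Fin nl × Zt m → ℝ} {zf : ℝ → Fin nf × Zt m → ℝ}

theorem mul_sign_self (x : ℝ) : x * Real.sign x = |x| := by
  rcases lt_trichotomy x 0 with h | h | h
  · rw [Real.sign_of_neg h, abs_of_neg h]; ring
  · simp [h]
  · rw [Real.sign_of_pos h, abs_of_pos h]; ring

/-- The factor `x` is frozen: at `x = 0` it erases the jump, and elsewhere the sign is locally
constant. -/
theorem continuousAt_mul_sign (x : ℝ) : ContinuousAt (fun y => x * Real.sign y) x := by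
  rcases lt_trichotomy x 0 with h | h | h
  · refine (continuousAt_const (y := x * -1)).congr ?_
    filter_upwards [Iio_mem_nhds h] with y hy
    rw [Real.sign_of_neg hy]
  · simpa [h] using continuousAt_const
  · refine (continuousAt_const (y := x * 1)).congr ?_
    filter_upwards [Ioi_mem_nhds h] with y hy
    rw [Real.sign_of_pos hy]

theorem continuous_mulVec {ι κ α : Type*} [Fintype κ] [TopologicalSpace α] (X : Matrix ι κ ℝ)
    {f : α → κ → ℝ} (hf : Continuous f) : Continuous fun y => X *ᵥ f y :=
  continuous_const.matrix_mulVec hf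

theorem continuous_stX (i : Fin nf) : Continuous fun y : Fin nf × Zt m → ℝ => stX y i :=
  continuous_pi fun _ => continuous_apply _

theorem continuous_stE (i : Fin nf) : Continuous fun y : Fin nf × Zt m → ℝ => stE y i :=
  continuous_pi fun _ => continuous_apply _

theorem continuous_followerError (z : Fin nl × Zt m → ℝ) :
    Continuous fun y : Fin nf × Zt m → ℝ => followerError F z y :=
  continuous_id.add continuous_const

theorem continuous_stE_followerError (z : Fin nl × Zt m → ℝ) (i : Fin nf) :
    Continuous fun y : Fin nf × Zt m → ℝ => stE (followerError F z y) i :=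
  (continuous_stE i).comp (continuous_followerError z)

theorem continuous_stX_followerError (z : Fin nl × Zt m → ℝ) (i : Fin nf) :
    Continuous fun y : Fin nf × Zt m → ℝ => stX (followerError F z y) i :=
  (continuous_stX i).comp (continuous_followerError z)

theorem continuous_observerCorrection (z : Fin nl × Zt m → ℝ) (i : Fin nf) :
    Continuous fun y : Fin nf × Zt m → ℝ =>
      c₁ • (L *ᵥ (C *ᵥ (stE (followerError F z y) i - stX (followerError F z y) i))) :=
  (continuous_mulVec L (continuous_mulVec C
    ((continuous_stE_followerError z i).sub (continuous_stX_followerError z i)))).const_smul c₁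

/-- The estimation part of a Filippov velocity is determined by the field. -/
theorem stE_sub_stX_of_mem_filippovMap (hF : F.Localizable) {t : ℝ} {x v : Fin nf × Zt m → ℝ}
    (hv : v ∈ filippovMap (fun z t => followerField F C K L c₁ c₂ (zl t) z) x t) (i : Fin nf) :
    stE v i - stX v i = stE (followerField F C K L c₁ c₂ (zl t) x) i
      - stX (followerField F C K L c₁ c₂ (zl t) x) i := by
  ext s
  refine linear_eq_of_mem_filippovMap hv
    ((LinearMap.proj (i, (Sum.inr s : Zt m)) : (Fin nf × Zt m → ℝ) →ₗ[ℝ] ℝ)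
      - LinearMap.proj (i, (Sum.inl s : Zt m))) ?_
  have hc : Continuous fun y : Fin nf × Zt m → ℝ =>
      (stE (followerField F C K L c₁ c₂ (zl t) y) i
        - stX (followerField F C K L c₁ c₂ (zl t) y) i) s := by
    simp only [stE_followerField hF, stX_followerField hF]
    -- The discontinuous input drives state and estimate alike through `B`, so it cancels in their
    -- difference.
    have h : Continuous fun y : Fin nf × Zt m → ℝ =>
        sysA m *ᵥ stE y i - sysA m *ᵥ stX y i + L *ᵥ (C *ᵥ (stE y i - stX y i))
          + c₁ • (L *ᵥ (C *ᵥ (stE (followerError F (zl t) y) i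
            - stX (followerError F (zl t) y) i))) :=
      (((continuous_mulVec _ (continuous_stE i)).sub (continuous_mulVec _ (continuous_stX i))).add
        (continuous_mulVec _ (continuous_mulVec _ ((continuous_stE i).sub (continuous_stX i))))).add
      (continuous_observerCorrection _ i)
    refine ((continuous_apply s).comp h).congr fun y => ?_
    refine congrFun (f := sysA m *ᵥ stE y i - sysA m *ᵥ stX y i + L *ᵥ (C *ᵥ (stE y i - stX y i))
      + c₁ • (L *ᵥ (C *ᵥ (stE (followerError F (zl t) y) i
        - stX (followerError F (zl t) y) i)))) ?_ s
    abel
  exact hc.continuousAt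

/-- The gain is the negative gradient in the input directions, so any input `w` acts on the Lyapunov
function through `-(Ke)·w`. -/
theorem dotProduct_sysB_mulVec {S : Matrix (St m) (St m) ℝ}
    (hK : K = -((sysB m)ᵀ * S)) (e : St m → ℝ) (w : Fin 3 → ℝ) :
    (S *ᵥ e) ⬝ᵥ (sysB m *ᵥ w) = -((K *ᵥ e) ⬝ᵥ w) := by
  rw [hK, Matrix.neg_mulVec, neg_dotProduct, neg_neg, ← Matrix.mulVec_mulVec,
    Matrix.dotProduct_mulVec, ← Matrix.mulVec_transpose]

/-- The component of a Filippov velocity along the gradient of the Lyapunov function is determined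
by the field. -/
theorem dotProduct_stE_of_mem_filippovMap (hF : F.Localizable) {S : Matrix (St m) (St m) ℝ}
    (hK : K = -((sysB m)ᵀ * S)) {t : ℝ} {x v : Fin nf × Zt m → ℝ}
    (hv : v ∈ filippovMap (fun z t => followerField F C K L c₁ c₂ (zl t) z) x t) (i : Fin nf) :
    (S *ᵥ stE (followerError F (zl t) x) i) ⬝ᵥ stE v i
      = (S *ᵥ stE (followerError F (zl t) x) i)
        ⬝ᵥ stE (followerField F C K L c₁ c₂ (zl t) x) i := by
  set e := stE (followerError F (zl t) x) i with he
  refine linear_eq_of_mem_filippovMap hv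
    { toFun := fun y => (S *ᵥ e) ⬝ᵥ stE y i
      map_add' := fun y z => dotProduct_add (S *ᵥ e) (stE y i) (stE z i)
      map_smul' := fun c y => dotProduct_smul c (S *ᵥ e) (stE y i) } ?_
  have hcE := continuous_stE_followerError (F := F) (zl t) i
  have h1 : Continuous fun y : Fin nf × Zt m → ℝ =>
      (S *ᵥ e) ⬝ᵥ (sysA m *ᵥ stE y i + sysB m *ᵥ (c₁ • (K *ᵥ stE (followerError F (zl t) y) i))
        + L *ᵥ (C *ᵥ (stE y i - stX y i)) + c₁ • (L *ᵥ (C *ᵥ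
          (stE (followerError F (zl t) y) i - stX (followerError F (zl t) y) i)))) := by
    refine continuous_const.dotProduct ((((continuous_mulVec _ (continuous_stE i)).add ?_).add
      (continuous_mulVec _ (continuous_mulVec _ ((continuous_stE i).sub (continuous_stX i))))).add
      (continuous_observerCorrection _ i))
    exact continuous_mulVec _ ((continuous_mulVec K hcE).const_smul c₁)
  -- With `e` frozen at `x`, each jump of the sign at `x` is multiplied by a zero component of `Ke`.
  have h2 : ContinuousAt (fun y : Fin nf × Zt m → ℝ => ∑ a, (K *ᵥ e) a
      * Real.sign ((K *ᵥ stE (followerError F (zl t) y) i) a)) x := by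
    refine tendsto_finsetSum _ fun a _ => ?_
    have hKc : ContinuousAt (fun y : Fin nf × Zt m → ℝ =>
        (K *ᵥ stE (followerError F (zl t) y) i) a) x :=
      ((continuous_apply a).comp (continuous_mulVec K hcE)).continuousAt
    exact ContinuousAt.comp (g := fun r => (K *ᵥ e) a * Real.sign r)
      (continuousAt_mul_sign _) hKc
  refine (h1.continuousAt.sub (h2.const_mul c₂)).congr (Eventually.of_forall fun y => ?_)
  change _ = (S *ᵥ e) ⬝ᵥ stE (followerField F C K L c₁ c₂ (zl t) y) i
  have h3 : ∑ a, (K *ᵥ e) a * Real.sign ((K *ᵥ stE (followerError F (zl t) y) i) a)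
      = (K *ᵥ e) ⬝ᵥ sgn (K *ᵥ stE (followerError F (zl t) y) i) := rfl
  rw [stE_followerField hF, Pi.sub_apply]
  rw [h3]
  simp only [Matrix.mulVec_add, dotProduct_add, dotProduct_sysB_mulVec hK, dotProduct_smul,
    smul_eq_mul]
  ring

theorem tendsto_estimation_error (hF : F.Localizable)
    (hH : H.PosDef) (hHlmi : (-((sysA m)ᵀ * H + H * sysA m - (2 : ℝ) • (Cᵀ * C))).PosDef)
    (hL : L = -(H⁻¹ * Cᵀ)) (hc₁ : 0 ≤ c₁)
    (hzl : HasAEDeriv zl (fun t => leaderField C L β p (zl t) t))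
    (hzf : IsFilippovSolution (fun z t => followerField F C K L c₁ c₂ (zl t) z) zf) (i : Fin nf) :
    Tendsto (fun t => stE (followerError F (zl t) (zf t)) i
      - stX (followerError F (zl t) (zf t)) i) atTop (𝓝 0) := by
  have he := hzl.followerError (F := F) hzf.hasAEDeriv
  refine HasAEDeriv.tendsto_zero_of_observer hH hHlmi hL (c := 1 + c₁) (by linarith)
    (((he.stE i).sub (he.stX i)).congr ?_)
  filter_upwards [hzf.ae_deriv_mem] with t ht
  have h1 := stE_sub_stX_of_mem_filippovMap hF ht i
  have h2 : stE (followerError F (leaderField C L β p (zl t) t) (deriv zf t)) i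
      - stX (followerError F (leaderField C L β p (zl t) t) (deriv zf t)) i
      = stE (followerError F (leaderField C L β p (zl t) t)
          (followerField F C K L c₁ c₂ (zl t) (zf t))) i
        - stX (followerError F (leaderField C L β p (zl t) t)
          (followerField F C K L c₁ c₂ (zl t) (zf t))) i := by
    simp only [stE_followerError, stX_followerError, add_sub_add_comm]
    rw [h1]
  rw [h2, stE_followerError_field hF, stX_followerError_field hF, Matrix.mulVec_sub (sysA m)]
  abel

/-- The dual form of the Lyapunov inequality for the feedback gain `K = -BᵀP⁻¹`. -/
theorem posDef_feedback_lmi {ι κ : Type*} [Fintype ι] [DecidableEq ι] [Fintype κ]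
    {A P : Matrix ι ι ℝ} {B : Matrix ι κ ℝ} {K : Matrix κ ι ℝ} (hP : P.PosDef)
    (hPlmi : (-(A * P + P * Aᵀ - (2 : ℝ) • (B * Bᵀ))).PosDef) (hK : K = -(Bᵀ * P⁻¹)) :
    (-(Aᵀ * P⁻¹ + P⁻¹ * A - (2 : ℝ) • (Kᵀ * K))).PosDef := by
  have hu : IsUnit P.det := (Matrix.isUnit_iff_isUnit_det _).1 hP.isUnit
  have hPt : (P⁻¹)ᵀ = P⁻¹ := by simpa [Matrix.IsHermitian] using hP.inv.isHermitian
  have hinj : Function.Injective (P⁻¹).mulVec :=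
    Matrix.mulVec_injective_of_isUnit hP.inv.isUnit
  -- Congruence with `P⁻¹` on both sides turns one inequality into the other.
  have h := hPlmi.conjTranspose_mul_mul_same hinj
  rw [Matrix.conjTranspose_eq_transpose_of_trivial, hPt] at h
  have hKK : Kᵀ * K = P⁻¹ * (B * Bᵀ) * P⁻¹ := by
    rw [hK]
    simp [Matrix.transpose_mul, hPt, Matrix.mul_assoc]
  convert h using 1
  rw [hKK, Matrix.mul_neg, Matrix.neg_mul, Matrix.mul_sub, Matrix.sub_mul, Matrix.mul_add,
    Matrix.add_mul, Matrix.mul_smul, Matrix.smul_mul, Matrix.nonsing_inv_mul_cancel_left _ _ hu,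
    ← Matrix.mul_assoc P⁻¹ A P, Matrix.mul_nonsing_inv_cancel_right _ _ hu,
    add_comm (Aᵀ * P⁻¹)]

/-- Lyapunov argument with `V = eᵀP⁻¹e`; the estimation error and the excess of the leader inputs
over `γ_u` enter only as a vanishing multiple of `‖e‖`. -/
theorem tendsto_estimated_error (hF : F.Localizable) (hP : P.PosDef)
    (hPlmi : (-(sysA m * P + P * (sysA m)ᵀ - (2 : ℝ) • (sysB m * (sysB m)ᵀ))).PosDef)
    (hK : K = -((sysB m)ᵀ * P⁻¹))
    (hzl : HasAEDeriv zl (fun t => leaderField C L β p (zl t) t))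
    {γu : ℝ} {κ : ℝ → ℝ} (hκ : Tendsto κ atTop (𝓝 0))
    (hu : ∀ t, 0 ≤ t → ∀ j a, |leaderInput β p (zl t) t j a| ≤ γu + κ t)
    (hc₁ : 1 < c₁) (hc₂ : nl * F.σ * γu ≤ c₂)
    (hzf : IsFilippovSolution (fun z t => followerField F C K L c₁ c₂ (zl t) z) zf) (i : Fin nf)
    (hD : Tendsto (fun t => stE (followerError F (zl t) (zf t)) i
      - stX (followerError F (zl t) (zf t)) i) atTop (𝓝 0)) :
    Tendsto (fun t => stE (followerError F (zl t) (zf t)) i) atTop (𝓝 0) := by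
  have he := hzl.followerError (F := F) hzf.hasAEDeriv
  have hS : (P⁻¹)ᵀ = P⁻¹ := by simpa [Matrix.IsHermitian] using hP.inv.isHermitian
  set D := fun t => stE (followerError F (zl t) (zf t)) i
      - stX (followerError F (zl t) (zf t)) i with hDdef
  set G := fun t => P⁻¹ *ᵥ (L *ᵥ (C *ᵥ D t)) with hGdef
  have hG : Tendsto G atTop (𝓝 0) :=
    tendsto_mulVec_zero _ (tendsto_mulVec_zero _ (tendsto_mulVec_zero _ hD))
  -- The first term bounds the part of the leader disturbance beyond `c₂`, the second the correction
  -- through `D`; the factors 2 come from differentiating a quadratic form.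
  have hk : Tendsto (fun t => 2 * ((nl * F.σ * |κ t|) * ∑ a, ∑ s, |K a s|)
      + 2 * (1 + c₁) * ∑ s, |G t s|) atTop (𝓝 0) := by
    have h1 := (((hκ.abs.const_mul (nl * F.σ)).mul_const (∑ a, ∑ s, |K a s|)).const_mul 2)
    have h2 := (tendsto_finsetSum Finset.univ fun s _ =>
      ((tendsto_pi_nhds.1 hG) s).abs).const_mul (2 * (1 + c₁))
    simpa using h1.add h2
  refine (he.stE i).tendsto_zero_of_lyapunov (posDef_feedback_lmi hP hPlmi hK) hP.inv hk ?_
  filter_upwards [hzf.ae_deriv_mem, ae_restrict_mem measurableSet_Ici] with t ht ht0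
  have h1 : (P⁻¹ *ᵥ stE (followerError F (zl t) (zf t)) i)
      ⬝ᵥ stE (followerError F (leaderField C L β p (zl t) t) (deriv zf t)) i
      = (P⁻¹ *ᵥ stE (followerError F (zl t) (zf t)) i)
      ⬝ᵥ stE (followerError F (leaderField C L β p (zl t) t)
          (followerField F C K L c₁ c₂ (zl t) (zf t))) i := by
    rw [stE_followerError F (leaderField C L β p (zl t) t) (deriv zf t),
      stE_followerError F (leaderField C L β p (zl t) t) (followerField _ _ _ _ _ _ _ _),
      dotProduct_add, dotProduct_add, dotProduct_stE_of_mem_filippovMap hF hK ht i]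
  rw [h1, stE_followerError_field hF, dotProduct_lmi_mulVec hP.inv.isHermitian]
  have hDt : stE (followerError F (zl t) (zf t)) i - stX (followerError F (zl t) (zf t)) i
      = D t := rfl
  rw [hDt]
  set e := stE (followerError F (zl t) (zf t)) i
  set w := leaderDisturbance F β p (zl t) t i with hw
  have hGe : (P⁻¹ *ᵥ e) ⬝ᵥ (L *ᵥ (C *ᵥ D t)) = e ⬝ᵥ G t := by
    rw [hGdef, Matrix.dotProduct_mulVec e, ← Matrix.mulVec_transpose, hS]
  have hGb : e ⬝ᵥ G t ≤ (∑ s, |G t s|) * ‖e‖ := (le_abs_self _).trans (abs_dotProduct_le _ _)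
  have hKK : 0 ≤ (K *ᵥ e) ⬝ᵥ (K *ᵥ e) := Finset.sum_nonneg fun _ _ => mul_self_nonneg _
  have hσ : 0 ≤ F.σ := Real.iSup_nonneg fun _ => abs_nonneg _
  have hr : 0 ≤ nl * F.σ * |κ t| := by positivity
  -- In each component the sign term contributes `c₂|(Ke)_a|`, while the disturbance takes away at
  -- most `(c₂ + n_l σ|κ|)|(Ke)_a|`; `c₂` cancels whatever its sign.
  have hterm : ∀ a, -((nl * F.σ * |κ t|) * ((∑ s, |K a s|) * ‖e‖))
      ≤ (K *ᵥ e) a * (c₂ • sgn (K *ᵥ e) + w) a := by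
    intro a
    have hwa : |w a| ≤ c₂ + nl * F.σ * |κ t| := by
      have h2 := abs_leaderDisturbance_le (F := F) (hu t ht0) i a
      have h3 : nl * F.σ * κ t ≤ nl * F.σ * |κ t| :=
        mul_le_mul_of_nonneg_left (le_abs_self _) (by positivity)
      rw [mul_add] at h2
      linarith
    have hKa : |(K *ᵥ e) a| ≤ (∑ s, |K a s|) * ‖e‖ := by
      have : (K *ᵥ e) a = e ⬝ᵥ K a := dotProduct_comm _ _
      rw [this]
      exact abs_dotProduct_le _ _
    have h4 : (K *ᵥ e) a * (c₂ • sgn (K *ᵥ e) + w) a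
        = c₂ * |(K *ᵥ e) a| + (K *ᵥ e) a * w a := by
      rw [← mul_sign_self]
      simp only [Pi.add_apply, Pi.smul_apply, smul_eq_mul, sgn]
      ring
    have h5 : -(|(K *ᵥ e) a| * |w a|) ≤ (K *ᵥ e) a * w a := by
      rw [← abs_mul]; exact neg_abs_le _
    have h6 := mul_le_mul_of_nonneg_left hwa (abs_nonneg ((K *ᵥ e) a))
    have h7 := mul_le_mul_of_nonneg_left hKa hr
    rw [h4]
    linarith
  have hsum : -((nl * F.σ * |κ t|) * ((∑ a, ∑ s, |K a s|) * ‖e‖))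
      ≤ (K *ᵥ e) ⬝ᵥ (c₂ • sgn (K *ᵥ e) + w) := by
    refine le_trans (le_of_eq ?_) (Finset.sum_le_sum fun a (_ : a ∈ Finset.univ) => hterm a)
    rw [Finset.sum_neg_distrib, ← Finset.mul_sum, ← Finset.sum_mul]
  have h8 : (1 + c₁) * (e ⬝ᵥ G t) ≤ (1 + c₁) * ((∑ s, |G t s|) * ‖e‖) :=
    mul_le_mul_of_nonneg_left hGb (by linarith)
  -- The matrix inequality uses `-2|Ke|²`; the surplus `-2(c₁-1)|Ke|²` is dropped.
  have h9 : 0 ≤ (c₁ - 1) * ((K *ᵥ e) ⬝ᵥ (K *ᵥ e)) := mul_nonneg (by linarith) hKK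
  rw [add_assoc (c₁ • (K *ᵥ e)), dotProduct_add, dotProduct_add, dotProduct_smul,
    dotProduct_sysB_mulVec hK, dotProduct_add, dotProduct_smul, hGe, smul_eq_mul, smul_eq_mul]
  linarith

end

end Formation

theorem theorem2 {nl nf m q : ℕ} (hm : 1 ≤ m)
    -- nominal formation
    (F : Formation.NominalFormation nl nf) (hF : F.Localizable)
    -- desired leader trajectories with bounded derivatives
    (p : Fin nl → ℝ → Fin 3 → ℝ) (γ : ℕ → ℝ) (hp : ∀ i, Formation.BoundedDerivs m γ (p i))
    -- output matrix and gains
    (C : Matrix (Fin q) (Formation.St m) ℝ)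
    (P H : Matrix (Formation.St m) (Formation.St m) ℝ)
    (hP : P.PosDef)
    (hPlmi : (-(Formation.sysA m * P + P * (Formation.sysA m)ᵀ
      - (2 : ℝ) • (Formation.sysB m * (Formation.sysB m)ᵀ))).PosDef)
    (hH : H.PosDef)
    (hHlmi : (-((Formation.sysA m)ᵀ * H + H * Formation.sysA m - (2 : ℝ) • (Cᵀ * C))).PosDef)
    (K : Matrix (Fin 3) (Formation.St m) ℝ) (hK : K = -((Formation.sysB m)ᵀ * P⁻¹))
    (L : Matrix (Formation.St m) (Fin q) ℝ) (hL : L = -(H⁻¹ * Cᵀ))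
    -- the leaders under their tracking controller
    (β : Fin m → ℝ) (hβ : Formation.IsHurwitz (Formation.W₁ β))
    (zl : ℝ → Fin nl × Formation.Zt m → ℝ)
    (hzl : Formation.IsCaratheodorySolution (Formation.leaderField C L β p) zl)
    (ζ : ℝ)
    (hζe : ∀ i, Formation.norm2
      (Formation.stX (zl 0) i - Formation.desiredState m (p i) 0) ≤ ζ)
    (hζη : ∀ i, Formation.norm2 (Formation.stE (zl 0) i - Formation.stX (zl 0) i) ≤ ζ)
    -- the constant `γ_u` that bounds the leader inputs
    (γu : ℝ)
    (hγu : Formation.IsLeaderInputConstant C L β ζ (γ m) γu ∨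
      ∀ i, ∀ t, 0 ≤ t → Formation.norm2 (Formation.leaderInput β p (zl t) t i) ≤ γu)
    -- coupling gains of the followers
    (c₁ c₂ : ℝ) (hc₁ : 1 < c₁) (hc₂ : nl * F.σ * γu ≤ c₂)
    -- a Filippov solution of the follower closed loop
    (zf : ℝ → Fin nf × Formation.Zt m → ℝ)
    (hzf : Formation.IsFilippovSolution
      (fun z t => Formation.followerField F C K L c₁ c₂ (zl t) z) zf) :
    Filter.Tendsto (fun t => Formation.followerError F (zl t) (zf t)) Filter.atTop (nhds 0) := by
  have hzl' := hzl.hasAEDeriv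
  obtain ⟨κ, hκ, hu⟩ :=
    Formation.exists_abs_leaderInput_le hp hm hH hHlmi hL hβ hzl' hζη hγu
  have hD := fun i =>
    Formation.tendsto_estimation_error hF hH hHlmi hL (zero_le_one.trans hc₁.le) hzl' hzf i
  have hE := fun i =>
    Formation.tendsto_estimated_error hF hP hPlmi hK hzl' hκ hu hc₁ hc₂ hzf i (hD i)
  rw [tendsto_pi_nhds]
  rintro ⟨i, s | s⟩
  -- The state component of the error is its estimate component minus `D`.
  · have h := tendsto_pi_nhds.1 ((hE i).sub (hD i)) s
    simpa [Formation.stX, Formation.stE] using h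
  · exact tendsto_pi_nhds.1 (hE i) s
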